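/- Let $(\Omega,\rho)$ be a metric space with $\operatorname{diam}(\Omega)\le 1$ that is doubling, i.e. for some finite $D$ every closed ball of radius $r>0$ is contained in the union of at most $D$ closed balls of radius $r/2$; let $D^*$ be the smallest such $D$ and $\operatorname{ddim}(\Omega)=\log_2 D^*$. An instance of the continuous local slope removal problem (CLSRP) consists of $n\ge 1$ sample points $x_1,\dots,x_n\in\Omega$ with labels $y_1,\dots,y_n\in\{0,1\}$ and a real $L>0$. For $z\in[0,1]^n$, the local slope at the $i$-th point is $\Lambda_z(i)=\max_{j}|z_i-z_j|/\rho(x_i,x_j)$, where $0/0=0$ and $a/0=\infty$ for $a>0$, and the number of relabeled points is $|\{i: z_i\ne y_i\}|$. CLSRP asks for the minimum number $k$ of relabeled points over all $z\in[0,1]^n$ that satisfy $$|\{i:\Lambda_z(i)\ge tL\}|\le n/t\qquad\text{for all real } t\in[1,n+1].$$ An $(a,b)$-bicriteria approximation is a $z\in[0,1]^n$ with at most $ak$ relabeled points such that $|\{i:\Lambda_z(i)\ge btL\}|\le n/t$ for all real $t\in[1,n+1]$. Claim: CLSRP admits a $(2^{O(\operatorname{ddim})}\log n,\,O(1))$-bicriteria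 approximation in time $O(n^2)+2^{O(\operatorname{ddim})}n\log^2 n$. That is, there are an absolute constant $C\ge 2$ and a single algorithm (a real-RAM program with unit-cost arithmetic and comparison of reals, unit-cost addition, truncated subtraction and comparison of natural numbers, unit-cost memory access, no conversion from reals to integers, and unit-cost access to the distances $\rho(x_i,x_j)$) such that, for every $(\Omega,\rho)$ as above and every instance, the algorithm, given $n$, $L$, $y$ and the distances, halts after at most $$C n^2+C\,2^{C\operatorname{ddim}(\Omega)}\,n\log^2 n$$ steps and outputs a $\bigl(C\,2^{C\operatorname{ddim}(\Omega)}\log n,\;C\bigr)$-bicriteria approximation. -/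

import Mathlib

open scoped ENNReal

universe u

namespace SlopeRemoval

/-! ### Doubling metric spaces -/

/-- Every closed ball is contained in the union of at most `D` closed balls of half its radius. -/
def DoublingWith (Ω : Type u) [MetricSpace Ω] (D : ℕ) : Prop :=
  ∀ (c : Ω) (r : ℝ), 0 < r → ∃ F : Finset Ω, F.card ≤ D ∧
    Metric.closedBall c r ⊆ ⋃ p ∈ F, Metric.closedBall p (r / 2)

/-- `(Ω, ρ)` is doubling, that is, its doubling dimension is finite. -/
def IsDoubling (Ω : Type u) [MetricSpace Ω] : Prop :=
  ∃ D : ℕ, DoublingWith Ω D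

/-- The doubling dimension `log₂ D*`, with `D*` the smallest doubling constant. It is meant for
doubling spaces only. -/
noncomputable def ddim (Ω : Type u) [MetricSpace Ω] : ℝ :=
  Real.logb 2 ((sInf {D : ℕ | DoublingWith Ω D} : ℕ) : ℝ)

/-! ### The continuous local slope removal problem -/

section Problem

variable {Ω : Type u} [MetricSpace Ω] {n : ℕ}

/-- The local slope of the labelling `z` at the `i`-th sample point,
`sup_j |z i - z j| / ρ(x i, x j)`. In `ℝ≥0∞` one has `0 / 0 = 0` and `a / 0 = ∞` for `a ≠ 0`: two
sample points at the same location do not interact if they carry the same label (in particular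
`j = i` contributes nothing), and have infinite slope otherwise. -/
noncomputable def slope (x : Fin n → Ω) (z : Fin n → ℝ) (i : Fin n) : ℝ≥0∞ :=
  ⨆ j : Fin n, ENNReal.ofReal |z i - z j| / edist (x i) (x j)

/-- For all real `t ∈ [1, n+1]`, at most `n / t` sample points have local slope `t L` or more. -/
def SlopeBounded (x : Fin n → Ω) (L : ℝ) (z : Fin n → ℝ) : Prop :=
  ∀ t : ℝ, 1 ≤ t → t ≤ (n : ℝ) + 1 →
    (({i : Fin n | ENNReal.ofReal (t * L) ≤ slope x z i}.ncard : ℕ) : ℝ) ≤ (n : ℝ) / t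

/-- The number of points of the sample with labels `y` that are relabelled by `z`. -/
noncomputable def relabelCount (y : Fin n → Fin 2) (z : Fin n → ℝ) : ℕ :=
  {i : Fin n | z i ≠ ((y i : ℕ) : ℝ)}.ncard

/-- `z` is a feasible relabelling for the slope target `L`. -/
def Feasible (x : Fin n → Ω) (L : ℝ) (z : Fin n → ℝ) : Prop :=
  (∀ i, z i ∈ Set.Icc (0 : ℝ) 1) ∧ SlopeBounded x L z

/-- Constant labellings are feasible, so the minimum below is over a nonempty set. -/
theorem feasible_const (x : Fin n → Ω) {L : ℝ} (hL : 0 < L) :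
    Feasible x L (fun _ => 0) := by
  refine ⟨fun _ => by simp, fun t ht _ => ?_⟩
  have hpos : 0 < t * L := by positivity
  have hs : {i : Fin n | ENNReal.ofReal (t * L) ≤ slope x (fun _ => (0 : ℝ)) i} = ∅ := by
    ext i
    simp [slope, hpos]
  rw [hs]
  simp only [Set.ncard_empty, Nat.cast_zero]
  positivity

/-- The minimal number of points that have to be relabelled (the optimum of the problem). -/
noncomputable def opt (x : Fin n → Ω) (y : Fin n → Fin 2) (L : ℝ) : ℕ :=
  sInf {k : ℕ | ∃ z : Fin n → ℝ, Feasible x L z ∧ relabelCount y z = k}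

/-- `z` is an `(a, b)`-bicriteria approximation: at most `a` times the minimal number of points
are relabelled, and at most `n / t` points have local slope `b t L` or more, `t ∈ [1, n+1]`. -/
def IsBicriteria (x : Fin n → Ω) (y : Fin n → Fin 2) (L a b : ℝ) (z : Fin n → ℝ) : Prop :=
  (∀ i, z i ∈ Set.Icc (0 : ℝ) 1) ∧
    (relabelCount y z : ℝ) ≤ a * (opt x y L : ℝ) ∧ SlopeBounded x (b * L) z

end Problem

/-! ### The machine model: a real RAM

Programs of a structured imperative language over two kinds of data: natural numbers, used for
indices and counters (with addition, truncated subtraction and comparison), and real numbers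
(with field operations and comparison). There are scalar variables and arrays of both kinds,
with array indices computed at run time. The only real constants are natural numbers, and no
instruction converts a real into a natural number (no rounding). The interpoint distances of the
sample are supplied by an oracle. Each operation, memory access and oracle call takes one step. -/

/-- The contents of the memory. -/
structure State where
  /-- scalar variables holding natural numbers -/
  natVar : ℕ → ℕ
  /-- scalar variables holding real numbers -/
  realVar : ℕ → ℝ
  /-- arrays of natural numbers: `natArr a i` is the `i`-th entry of the array named `a` -/
  natArr : ℕ → ℕ → ℕ
  /-- arrays of real numbers -/
  realArr : ℕ → ℕ → ℝ

/-- Expressions with a natural number as value. -/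
inductive NatExpr where
  | const (c : ℕ)
  | var (v : ℕ)
  | get (a : ℕ) (i : NatExpr)
  | add (e f : NatExpr)
  | sub (e f : NatExpr)

/-- The value of an expression. -/
def NatExpr.eval (s : State) : NatExpr → ℕ
  | .const c => c
  | .var v => s.natVar v
  | .get a i => s.natArr a (i.eval s)
  | .add e f => e.eval s + f.eval s
  | .sub e f => e.eval s - f.eval s

/-- The number of steps that the evaluation takes. -/
def NatExpr.cost : NatExpr → ℕ
  | .const _ => 1
  | .var _ => 1
  | .get _ i => i.cost + 1
  | .add e f => e.cost + f.cost + 1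
  | .sub e f => e.cost + f.cost + 1

/-- Expressions with a real number as value; `dist i j` calls the distance oracle. -/
inductive RealExpr where
  | ofNat (e : NatExpr)
  | var (v : ℕ)
  | get (a : ℕ) (i : NatExpr)
  | dist (i j : NatExpr)
  | add (e f : RealExpr)
  | sub (e f : RealExpr)
  | mul (e f : RealExpr)
  | div (e f : RealExpr)

/-- The value of an expression, for the distance oracle `d`. -/
noncomputable def RealExpr.eval (d : ℕ → ℕ → ℝ) (s : State) : RealExpr → ℝ
  | .ofNat e => (e.eval s : ℝ)
  | .var v => s.realVar v
  | .get a i => s.realArr a (i.eval s)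
  | .dist i j => d (i.eval s) (j.eval s)
  | .add e f => e.eval d s + f.eval d s
  | .sub e f => e.eval d s - f.eval d s
  | .mul e f => e.eval d s * f.eval d s
  | .div e f => e.eval d s / f.eval d s

/-- The number of steps that the evaluation takes. -/
def RealExpr.cost : RealExpr → ℕ
  | .ofNat e => e.cost + 1
  | .var _ => 1
  | .get _ i => i.cost + 1
  | .dist i j => i.cost + j.cost + 1
  | .add e f => e.cost + f.cost + 1
  | .sub e f => e.cost + f.cost + 1
  | .mul e f => e.cost + f.cost + 1
  | .div e f => e.cost + f.cost + 1

/-- Tests. -/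
inductive Test where
  | natLt (e f : NatExpr)
  | natEq (e f : NatExpr)
  | realLt (e f : RealExpr)
  | realLe (e f : RealExpr)
  | not (b : Test)
  | and (b c : Test)

/-- The test succeeds. -/
def Test.Holds (d : ℕ → ℕ → ℝ) (s : State) : Test → Prop
  | .natLt e f => e.eval s < f.eval s
  | .natEq e f => e.eval s = f.eval s
  | .realLt e f => e.eval d s < f.eval d s
  | .realLe e f => e.eval d s ≤ f.eval d s
  | .not b => ¬ b.Holds d s
  | .and b c => b.Holds d s ∧ c.Holds d s

/-- The number of steps that the test takes. -/
def Test.cost : Test → ℕ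
  | .natLt e f => e.cost + f.cost + 1
  | .natEq e f => e.cost + f.cost + 1
  | .realLt e f => e.cost + f.cost + 1
  | .realLe e f => e.cost + f.cost + 1
  | .not b => b.cost + 1
  | .and b c => b.cost + c.cost + 1

/-- Programs. -/
inductive Program where
  | skip
  | setNat (v : ℕ) (e : NatExpr)
  | setReal (v : ℕ) (e : RealExpr)
  | putNat (a : ℕ) (i : NatExpr) (e : NatExpr)
  | putReal (a : ℕ) (i : NatExpr) (e : RealExpr)
  | seq (p q : Program)
  | ite (b : Test) (p q : Program)
  | loop (b : Test) (p : Program)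

/-- Overwrite the `i`-th entry of the array named `a` by `c`. -/
def writeArr {α : Type} (m : ℕ → ℕ → α) (a i : ℕ) (c : α) : ℕ → ℕ → α :=
  Function.update m a (Function.update (m a) i c)

/-- `Exec d p s T s'`: with the distance oracle `d`, the program `p` started in `s` halts in `s'`
after exactly `T` steps. (The rules are syntax-directed: `T` and `s'` are determined by `d`, `p`
and `s`.) `loop b p` is the while loop. -/
inductive Exec (d : ℕ → ℕ → ℝ) : Program → State → ℕ → State → Prop where
  | skip (s : State) : Exec d .skip s 1 s
  | setNat (v : ℕ) (e : NatExpr) (s : State) :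
      Exec d (.setNat v e) s (e.cost + 1)
        { s with natVar := Function.update s.natVar v (e.eval s) }
  | setReal (v : ℕ) (e : RealExpr) (s : State) :
      Exec d (.setReal v e) s (e.cost + 1)
        { s with realVar := Function.update s.realVar v (e.eval d s) }
  | putNat (a : ℕ) (i e : NatExpr) (s : State) :
      Exec d (.putNat a i e) s (i.cost + e.cost + 1)
        { s with natArr := writeArr s.natArr a (i.eval s) (e.eval s) }
  | putReal (a : ℕ) (i : NatExpr) (e : RealExpr) (s : State) :
      Exec d (.putReal a i e) s (i.cost + e.cost + 1)
        { s with realArr := writeArr s.realArr a (i.eval s) (e.eval d s) }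
  | seq {p q : Program} {s s' s'' : State} {T T' : ℕ} :
      Exec d p s T s' → Exec d q s' T' s'' → Exec d (.seq p q) s (T + T') s''
  | iteTrue {b : Test} {p q : Program} {s s' : State} {T : ℕ} :
      b.Holds d s → Exec d p s T s' → Exec d (.ite b p q) s (b.cost + 1 + T) s'
  | iteFalse {b : Test} {p q : Program} {s s' : State} {T : ℕ} :
      ¬ b.Holds d s → Exec d q s T s' → Exec d (.ite b p q) s (b.cost + 1 + T) s'
  | loopDone {b : Test} {p : Program} {s : State} :
      ¬ b.Holds d s → Exec d (.loop b p) s (b.cost + 1) s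
  | loopStep {b : Test} {p : Program} {s s' s'' : State} {T T' : ℕ} :
      b.Holds d s → Exec d p s T s' → Exec d (.loop b p) s' T' s'' →
        Exec d (.loop b p) s (b.cost + 1 + T + T') s''

/-! ### Input and output -/

/-- The distance oracle of a sample; it answers `0` on indices out of range. -/
noncomputable def distOracle {Ω : Type u} [MetricSpace Ω] {n : ℕ} (x : Fin n → Ω) (i j : ℕ) : ℝ :=
  if h : i < n ∧ j < n then dist (x ⟨i, h.1⟩) (x ⟨j, h.2⟩) else 0

/-- The initial memory: the natural variable `0` holds `n`, the real variable `0` holds `L`, the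
first `n` entries of the array `0` of natural numbers hold the labels; everything else is `0`. -/
noncomputable def initState {n : ℕ} (y : Fin n → Fin 2) (L : ℝ) : State where
  natVar := fun v => if v = 0 then n else 0
  realVar := fun v => if v = 0 then L else 0
  natArr := fun a i => if h : a = 0 ∧ i < n then (y ⟨i, h.2⟩ : ℕ) else 0
  realArr := fun _ _ => 0

/-- The output: the new labels are the first `n` entries of the array `0` of real numbers. -/
def output (n : ℕ) (s : State) : Fin n → ℝ :=
  fun i => s.realArr 0 i

end SlopeRemoval

/-! Relabelling amounts to choosing a set `U` of points to keep. Call a point `r`-steep for `U` if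
its distances to some kept point labelled `0` and some kept point labelled `1` add up to at most
`r`. If `U` is the kept set of a feasible `z`, a point that is `1/(TL)`-steep has slope at least
`TL`, so at most `n/T` points are steep (`Feasible.card_steepSet_le`). Conversely, if `α` and `β`
are the distances to the kept points of either label, truncated at `1/L`, then `α/(α+β)` keeps the
labels on `U` and has slope at most `1/(α+β)`, which is large only at steep points
(`interpolation_bounds`). Up to constants the task is thus to delete few points so that few are
steep at every scale. The scales `T = 4^k ≤ 8n+8` suffice (`card_steepSet_le_of_dyadic`). They can
be treated independently, since further deletions only shrink the steep sets; adding up the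
deletions over `O(log n)` scales gives the logarithmic factor.

At one scale, cluster the points around a net of radius `ρ = 1/(10TL)`. Cleaning a cluster means
deleting the minority label from the clusters with centres within `3ρ`. Every cluster is cleaned or
exempt, and the exempt ones may contain `2n/T` points in all: a knapsack problem. It is solved
approximately by a threshold `τ` on cost per point, doubled until the exempt clusters fit. Let `O`
be the clusters whose neighbourhood contains points of both labels kept by the optimum. Their points
are `10ρ`-steep, so `O` has at most `n/T` points; each cluster outside `O` is already cleaned by the
optimum, so by packing (`DoublingWith.card_le_of_separated`) those costs add up to at most `D³`
times the optimum. The clusters in `O` that are not exempt cost at most `τ n/T`, while at the rate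
`τ/2` more than `n/T` exempt points lie outside `O`, which shows that `τ n/T` is at most twice the
same bound (`ScaleData.card_del_le_of_rate`).

For the running time, the net is only ever refined. Old centres are more than `3ρ` apart, so every
pair examined involves a new centre, and this work is `O(n)` per centre, hence `O(n²)` over all
scales. The choice of `τ` costs `O(n log n)` per scale, and interpolation costs `O(n²)`. The program
uses neither the doubling constant nor the optimum. -/

namespace SlopeRemoval

/-! ### Weakest preconditions and frames -/

/-- Some run of `p` from `s` halts, with the number of steps and the final state satisfying `Q`. -/
def WP (d : ℕ → ℕ → ℝ) (p : Program) (s : State) (Q : ℕ → State → Prop) : Prop :=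
  ∃ T s', Exec d p s T s' ∧ Q T s'

/-- The program may write to the scalar natural variable `w`. -/
def Program.writesNatVar : Program → ℕ → Bool
  | .setNat v _, w => v == w
  | .seq p q, w => p.writesNatVar w || q.writesNatVar w
  | .ite _ p q, w => p.writesNatVar w || q.writesNatVar w
  | .loop _ p, w => p.writesNatVar w
  | _, _ => false

/-- The program may write to the scalar real variable `w`. -/
def Program.writesRealVar : Program → ℕ → Bool
  | .setReal v _, w => v == w
  | .seq p q, w => p.writesRealVar w || q.writesRealVar w
  | .ite _ p q, w => p.writesRealVar w || q.writesRealVar w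
  | .loop _ p, w => p.writesRealVar w
  | _, _ => false

/-- The program may write to the array `w` of natural numbers. -/
def Program.writesNatArr : Program → ℕ → Bool
  | .putNat a _ _, w => a == w
  | .seq p q, w => p.writesNatArr w || q.writesNatArr w
  | .ite _ p q, w => p.writesNatArr w || q.writesNatArr w
  | .loop _ p, w => p.writesNatArr w
  | _, _ => false

/-- The program may write to the array `w` of real numbers. -/
def Program.writesRealArr : Program → ℕ → Bool
  | .putReal a _ _, w => a == w
  | .seq p q, w => p.writesRealArr w || q.writesRealArr w
  | .ite _ p q, w => p.writesRealArr w || q.writesRealArr w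
  | .loop _ p, w => p.writesRealArr w
  | _, _ => false

/-- The states `s` and `s'` agree on everything that `p` does not write to. -/
structure Frame (p : Program) (s s' : State) : Prop where
  natVar : ∀ v, p.writesNatVar v = false → s'.natVar v = s.natVar v
  realVar : ∀ v, p.writesRealVar v = false → s'.realVar v = s.realVar v
  natArr : ∀ a, p.writesNatArr a = false → s'.natArr a = s.natArr a
  realArr : ∀ a, p.writesRealArr a = false → s'.realArr a = s.realArr a

theorem Frame.refl (p : Program) (s : State) : Frame p s s :=
  ⟨fun _ _ => rfl, fun _ _ => rfl, fun _ _ => rfl, fun _ _ => rfl⟩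

theorem Frame.trans {p : Program} {s s' s'' : State} (h : Frame p s s') (h' : Frame p s' s'') :
    Frame p s s'' :=
  ⟨fun v hv => (h'.natVar v hv).trans (h.natVar v hv),
    fun v hv => (h'.realVar v hv).trans (h.realVar v hv),
    fun v hv => (h'.natArr v hv).trans (h.natArr v hv),
    fun v hv => (h'.realArr v hv).trans (h.realArr v hv)⟩

theorem writeArr_same {α : Type} (m : ℕ → ℕ → α) (a i : ℕ) (c : α) :
    writeArr m a i c a = Function.update (m a) i c := by
  simp [writeArr]

theorem writeArr_ne {α : Type} (m : ℕ → ℕ → α) {a b : ℕ} (i : ℕ) (c : α) (h : b ≠ a) :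
    writeArr m a i c b = m b := by
  simp [writeArr, h]

/-- This turns preservation of memory into a check on the program text: for concrete programs the
side conditions of `Frame` hold by `rfl`. -/
theorem Exec.frame {d : ℕ → ℕ → ℝ} {p : Program} {s s' : State} {T : ℕ}
    (h : Exec d p s T s') : Frame p s s' := by
  induction h with
  | skip s => exact .refl _ _
  | setNat v e s =>
    refine ⟨fun w hw => ?_, fun _ _ => rfl, fun _ _ => rfl, fun _ _ => rfl⟩
    exact Function.update_of_ne (by rintro rfl; simp [Program.writesNatVar] at hw) _ _
  | setReal v e s =>
    refine ⟨fun _ _ => rfl, fun w hw => ?_, fun _ _ => rfl, fun _ _ => rfl⟩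
    exact Function.update_of_ne (by rintro rfl; simp [Program.writesRealVar] at hw) _ _
  | putNat a i e s =>
    refine ⟨fun _ _ => rfl, fun _ _ => rfl, fun w hw => ?_, fun _ _ => rfl⟩
    exact writeArr_ne _ _ _ (by rintro rfl; simp [Program.writesNatArr] at hw)
  | putReal a i e s =>
    refine ⟨fun _ _ => rfl, fun _ _ => rfl, fun _ _ => rfl, fun w hw => ?_⟩
    exact writeArr_ne _ _ _ (by rintro rfl; simp [Program.writesRealArr] at hw)
  | seq _ _ ih ih' =>
    constructor <;> intro v hv <;>
      simp only [Program.writesNatVar, Program.writesRealVar, Program.writesNatArr,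
        Program.writesRealArr, Bool.or_eq_false_iff] at hv
    · exact (ih'.natVar v hv.2).trans (ih.natVar v hv.1)
    · exact (ih'.realVar v hv.2).trans (ih.realVar v hv.1)
    · exact (ih'.natArr v hv.2).trans (ih.natArr v hv.1)
    · exact (ih'.realArr v hv.2).trans (ih.realArr v hv.1)
  | iteTrue _ _ ih =>
    constructor <;> intro v hv <;>
      simp only [Program.writesNatVar, Program.writesRealVar, Program.writesNatArr,
        Program.writesRealArr, Bool.or_eq_false_iff] at hv
    · exact ih.natVar v hv.1
    · exact ih.realVar v hv.1
    · exact ih.natArr v hv.1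
    · exact ih.realArr v hv.1
  | iteFalse _ _ ih =>
    constructor <;> intro v hv <;>
      simp only [Program.writesNatVar, Program.writesRealVar, Program.writesNatArr,
        Program.writesRealArr, Bool.or_eq_false_iff] at hv
    · exact ih.natVar v hv.2
    · exact ih.realVar v hv.2
    · exact ih.natArr v hv.2
    · exact ih.realArr v hv.2
  | loopDone _ => exact .refl _ _
  | loopStep _ _ _ ih ih' =>
    exact .trans ⟨ih.natVar, ih.realVar, ih.natArr, ih.realArr⟩ ih'

/-! ### Proof rules for total correctness with running time -/

section Rules

variable {d : ℕ → ℕ → ℝ} {s : State} {Q : ℕ → State → Prop}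

theorem WP.mono {p : Program} {R : ℕ → State → Prop} (h : WP d p s R)
    (hRQ : ∀ T s', Frame p s s' → R T s' → Q T s') : WP d p s Q := by
  obtain ⟨T, s', he, hR⟩ := h
  exact ⟨T, s', he, hRQ T s' he.frame hR⟩

theorem WP.skip (h : Q 1 s) : WP d .skip s Q := ⟨_, _, .skip s, h⟩

theorem WP.setNat {v : ℕ} {e : NatExpr}
    (h : Q (e.cost + 1) { s with natVar := Function.update s.natVar v (e.eval s) }) :
    WP d (.setNat v e) s Q := ⟨_, _, .setNat v e s, h⟩

theorem WP.setReal {v : ℕ} {e : RealExpr}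
    (h : Q (e.cost + 1) { s with realVar := Function.update s.realVar v (e.eval d s) }) :
    WP d (.setReal v e) s Q := ⟨_, _, .setReal v e s, h⟩

theorem WP.putNat {a : ℕ} {i e : NatExpr}
    (h : Q (i.cost + e.cost + 1) { s with natArr := writeArr s.natArr a (i.eval s) (e.eval s) }) :
    WP d (.putNat a i e) s Q := ⟨_, _, .putNat a i e s, h⟩

theorem WP.putReal {a : ℕ} {i : NatExpr} {e : RealExpr}
    (h : Q (i.cost + e.cost + 1)
      { s with realArr := writeArr s.realArr a (i.eval s) (e.eval d s) }) :
    WP d (.putReal a i e) s Q := ⟨_, _, .putReal a i e s, h⟩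

theorem WP.seq {p q : Program}
    (h : WP d p s fun T s' => WP d q s' fun T' s'' => Q (T + T') s'') :
    WP d (.seq p q) s Q := by
  obtain ⟨T, s', he, T', s'', he', hQ⟩ := h
  exact ⟨_, _, .seq he he', hQ⟩

theorem WP.ite {b : Test} {p q : Program}
    (h₁ : b.Holds d s → WP d p s fun T s' => Q (b.cost + 1 + T) s')
    (h₂ : ¬ b.Holds d s → WP d q s fun T s' => Q (b.cost + 1 + T) s') :
    WP d (.ite b p q) s Q := by
  by_cases hb : b.Holds d s
  · obtain ⟨T, s', he, hQ⟩ := h₁ hb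
    exact ⟨_, _, .iteTrue hb he, hQ⟩
  · obtain ⟨T, s', he, hQ⟩ := h₂ hb
    exact ⟨_, _, .iteFalse hb he, hQ⟩

/-- While loops: `I k t s` is the invariant after `k` rounds and `t` steps. -/
theorem WP.loop {b : Test} {p : Program} (I : ℕ → ℕ → State → Prop) (K : ℕ) (h₀ : I 0 0 s)
    (hstep : ∀ k t s', Frame p s s' → I k t s' → b.Holds d s' →
      k < K ∧ WP d p s' fun T s'' => I (k + 1) (t + (b.cost + 1 + T)) s'')
    (hend : ∀ k t s', k ≤ K → Frame p s s' → I k t s' → ¬ b.Holds d s' → Q (t + (b.cost + 1)) s') :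
    WP d (.loop b p) s Q := by
  -- Here `m` is the number of rounds still allowed; at `m = 0` the claim `k < K` of `hstep` forces
  -- the test to fail.
  suffices H : ∀ m k t s', m + k = K → Frame p s s' → I k t s' →
      WP d (.loop b p) s' fun T s'' => Q (t + T) s'' by
    obtain ⟨T, s', he, hQ⟩ := H K 0 0 s (by simp) (.refl _ _) h₀
    exact ⟨T, s', he, by simpa using hQ⟩
  intro m
  induction m with
  | zero =>
    intro k t s' hk hF hI
    have hb : ¬ b.Holds d s' := fun hb => absurd (hstep k t s' hF hI hb).1 (by omega)
    exact ⟨_, _, .loopDone hb, hend k t s' (by omega) hF hI hb⟩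
  | succ m ih =>
    intro k t s' hk hF hI
    by_cases hb : b.Holds d s'
    · obtain ⟨-, T, s'', he, hI'⟩ := hstep k t s' hF hI hb
      obtain ⟨T', s₃, he', hQ⟩ := ih (k + 1) _ s'' (by omega) (hF.trans he.frame) hI'
      exact ⟨_, _, .loopStep hb he he', by simpa [add_assoc] using hQ⟩
    · exact ⟨_, _, .loopDone hb, hend k t s' (by omega) hF hI hb⟩

/-- `for (; v < w; v++) body`. -/
def forLoop (v w : ℕ) (body : Program) : Program :=
  .loop (.natLt (.var v) (.var w)) (.seq body (.setNat v (.add (.var v) (.const 1))))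

/-- For loops: `I k t s` is the invariant at counter value `k`, after `t` steps. -/
theorem WP.for {v w : ℕ} {body : Program} (I : ℕ → ℕ → State → Prop) {k₀ N : ℕ}
    (hv : body.writesNatVar v = false) (hw : body.writesNatVar w = false) (hvw : v ≠ w)
    (hk₀ : s.natVar v = k₀) (hN : s.natVar w = N) (hle : k₀ ≤ N) (h₀ : I k₀ 0 s)
    (hstep : ∀ k t s', Frame (forLoop v w body) s s' → k₀ ≤ k → k < N → s'.natVar v = k →
      I k t s' → WP d body s' fun T s'' => I (k + 1) (t + T + 8)
        { s'' with natVar := Function.update s''.natVar v (k + 1) })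
    (hend : ∀ t s', Frame (forLoop v w body) s s' → I N t s' → Q (t + 4) s') :
    WP d (forLoop v w body) s Q := by
  have hw' : (forLoop v w body).writesNatVar w = false := by
    simp [forLoop, Program.writesNatVar, hw, hvw]
  refine WP.loop (fun k t s' => I (k₀ + k) t s' ∧ s'.natVar v = k₀ + k ∧ k₀ + k ≤ N) (N - k₀)
    ⟨by simpa using h₀, by simpa using hk₀, by omega⟩ ?_ ?_
  · rintro k t s' hF ⟨hI, hk, hkN⟩ hb
    have hF' : Frame (forLoop v w body) s s' := ⟨hF.natVar, hF.realVar, hF.natArr, hF.realArr⟩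
    have hb' : k₀ + k < N := by
      have : s'.natVar v < s'.natVar w := hb
      rw [hF'.natVar w hw', hN, hk] at this
      exact this
    refine ⟨by omega, .seq ?_⟩
    refine (hstep (k₀ + k) t s' hF' (by omega) hb' hk hI).mono fun T s'' hF'' hI' => ?_
    refine .setNat ⟨?_, ?_, by omega⟩
    · have e : (NatExpr.add (.var v) (.const 1)).eval s'' = k₀ + k + 1 := by
        simp [NatExpr.eval, hF''.natVar v hv, hk]
      rw [e]
      -- The overhead of a round is `8`: four steps for the test and four for the increment.
      have e' : t + ((Test.natLt (.var v) (.var w)).cost + 1 +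
          (T + ((NatExpr.add (.var v) (.const 1)).cost + 1))) = t + T + 8 := by
        simp only [Test.cost, NatExpr.cost]
        omega
      rw [e']
      exact hI'
    · simp [NatExpr.eval, hF''.natVar v hv, hk, add_assoc]
  · rintro k t s' - hF ⟨hI, hk, hkN⟩ hb
    have hF' : Frame (forLoop v w body) s s' := ⟨hF.natVar, hF.realVar, hF.natArr, hF.realArr⟩
    have hb' : ¬ k₀ + k < N := by
      have : ¬ s'.natVar v < s'.natVar w := hb
      rw [hF'.natVar w hw', hN, hk] at this
      exact this
    have : k₀ + k = N := by omega
    exact hend t s' hF' (this ▸ hI)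

/-- For loops whose body has bounded cost `c`. -/
theorem WP.for_const {v w : ℕ} {body : Program} (I : ℕ → State → Prop) {k₀ N : ℕ} (c : ℕ)
    (hv : body.writesNatVar v = false) (hw : body.writesNatVar w = false) (hvw : v ≠ w)
    (hk₀ : s.natVar v = k₀) (hN : s.natVar w = N) (hle : k₀ ≤ N) (h₀ : I k₀ s)
    (hstep : ∀ k s', Frame (forLoop v w body) s s' → k₀ ≤ k → k < N → s'.natVar v = k →
      I k s' → WP d body s' fun T s'' => T ≤ c ∧ I (k + 1)
        { s'' with natVar := Function.update s''.natVar v (k + 1) })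
    (hend : ∀ T s', Frame (forLoop v w body) s s' → T ≤ (N - k₀) * (c + 8) + 4 → I N s' → Q T s') :
    WP d (forLoop v w body) s Q := by
  refine WP.for (fun k t s' => t ≤ (k - k₀) * (c + 8) ∧ I k s') hv hw hvw hk₀ hN hle
    ⟨by simp, h₀⟩ ?_ ?_
  · rintro k t s' hF hk hkN hsk ⟨ht, hI⟩
    refine (hstep k s' hF hk hkN hsk hI).mono ?_
    rintro T s'' - ⟨hT, hI'⟩
    refine ⟨?_, hI'⟩
    rw [show k + 1 - k₀ = (k - k₀) + 1 by omega, add_mul]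
    omega
  · rintro t s' hF ⟨ht, hI⟩
    exact hend _ s' hF (by omega) hI

end Rules

open Finset

/-! ### Packing in doubling spaces -/

section Packing

variable {Ω : Type u} [MetricSpace Ω]

theorem DoublingWith.exists_cover {D : ℕ} (hD : DoublingWith Ω D) (c : Ω) {r : ℝ} (hr : 0 < r)
    (k : ℕ) : ∃ F : Finset Ω, F.card ≤ D ^ k ∧
      ∀ q, dist q c ≤ r → ∃ p ∈ F, dist q p ≤ r / 2 ^ k := by
  classical
  induction k with
  | zero => exact ⟨{c}, by simp, fun q hq => ⟨c, by simp, by simpa using hq⟩⟩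
  | succ k ih =>
    obtain ⟨F, hF, hcov⟩ := ih
    choose G hG hGcov using fun p : Ω => hD p (r / 2 ^ k) (by positivity)
    refine ⟨F.biUnion G, ?_, fun q hq => ?_⟩
    · calc (F.biUnion G).card ≤ F.card * D := card_biUnion_le_card_mul _ _ _ fun p _ => hG p
        _ ≤ D ^ (k + 1) := by rw [pow_succ]; gcongr
    · obtain ⟨p, hp, hqp⟩ := hcov q hq
      have := hGcov p (show q ∈ Metric.closedBall p (r / 2 ^ k) from hqp)
      simp only [Set.mem_iUnion, Metric.mem_closedBall] at this
      obtain ⟨p', hp', hqp'⟩ := this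
      refine ⟨p', mem_biUnion.2 ⟨p, hp, hp'⟩, ?_⟩
      rwa [pow_succ, ← div_div]

/-- Three halvings cover the ball of radius `3ρ` by balls of radius `3ρ/8`, and two points sharing
such a ball are at distance at most `3ρ/4 < ρ`. Two halvings would not be enough. -/
theorem DoublingWith.card_le_of_separated {D : ℕ} (hD : DoublingWith Ω D) {ι : Type*}
    (S : Finset ι) (P : ι → Ω) (c : Ω) {ρ : ℝ} (hρ : 0 < ρ) (hS : ∀ i ∈ S, dist (P i) c ≤ 3 * ρ)
    (hsep : ∀ i ∈ S, ∀ j ∈ S, i ≠ j → ρ < dist (P i) (P j)) : S.card ≤ D ^ 3 := by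
  classical
  obtain ⟨F, hF, hcov⟩ := hD.exists_cover c (r := 3 * ρ) (by positivity) 3
  refine le_trans ?_ hF
  have : Inhabited Ω := ⟨c⟩
  choose! g hg hg' using fun i (hi : i ∈ S) => hcov (P i) (hS i hi)
  refine card_le_card_of_injOn g hg fun i hi j hj hij => ?_
  by_contra hne
  have h1 := hsep i hi j hj hne
  have h2 := dist_triangle_right (P i) (P j) (g i)
  have h3 := hg' i hi
  have h4 := hg' j hj
  rw [← hij] at h4
  linarith

end Packing

/-! ### Slopes and distances to the kept points -/

section Slope

variable {Ω : Type u} [MetricSpace Ω]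

open Classical in
/-- The points whose distances to the points of `U` labelled `0` and to those labelled `1` add up
to at most `r`. -/
noncomputable def steepSet (n : ℕ) (X : ℕ → Ω) (Y : ℕ → ℕ) (U : Finset ℕ) (r : ℝ) : Finset ℕ :=
  {i ∈ range n | ∃ u ∈ U, ∃ v ∈ U, Y u = 0 ∧ Y v ≠ 0 ∧ dist (X i) (X u) + dist (X i) (X v) ≤ r}

theorem mem_steepSet {n : ℕ} {X : ℕ → Ω} {Y : ℕ → ℕ} {U : Finset ℕ} {r : ℝ} {i : ℕ} :
    i ∈ steepSet n X Y U r ↔ i < n ∧ ∃ u ∈ U, ∃ v ∈ U, Y u = 0 ∧ Y v ≠ 0 ∧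
      dist (X i) (X u) + dist (X i) (X v) ≤ r := by
  simp [steepSet]

theorem steepSet_mono {n : ℕ} {X : ℕ → Ω} {Y : ℕ → ℕ} {U V : Finset ℕ} {r r' : ℝ} (hU : U ⊆ V)
    (hr : r ≤ r') : steepSet n X Y U r ⊆ steepSet n X Y V r' := by
  intro i hi
  obtain ⟨h, u, hu, v, hv, h0, h1, h2⟩ := mem_steepSet.1 hi
  exact mem_steepSet.2 ⟨h, u, hU hu, v, hU hv, h0, h1, h2.trans hr⟩

/-- At distance zero a finite slope forces equal labels because `a / 0 = ∞`; there only the weak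
inequality survives, hence the two-part conclusion. -/
theorem abs_sub_le_of_slope_lt {n : ℕ} {x : Fin n → Ω} {z : Fin n → ℝ} {i : Fin n} {M : ℝ}
    (h : slope x z i < ENNReal.ofReal M) (j : Fin n) :
    |z i - z j| ≤ M * dist (x i) (x j) ∧
      (0 < dist (x i) (x j) → |z i - z j| < M * dist (x i) (x j)) := by
  have hM : 0 < M := ENNReal.ofReal_pos.1 (pos_of_gt h)
  have hj : ENNReal.ofReal |z i - z j| / edist (x i) (x j) < ENNReal.ofReal M :=
    (le_iSup (fun j => ENNReal.ofReal |z i - z j| / edist (x i) (x j)) j).trans_lt h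
  rcases (dist_nonneg (x := x i) (y := x j)).eq_or_lt with h0 | h0
  · refine ⟨?_, fun h1 => absurd h1 (by rw [← h0]; simp)⟩
    rw [edist_dist, ← h0] at hj
    by_contra hne
    rw [← h0, mul_zero, not_le] at hne
    rw [ENNReal.ofReal_zero, ENNReal.div_zero (by simpa using hne)] at hj
    exact absurd hj (by simp)
  · have : |z i - z j| < M * dist (x i) (x j) := by
      rw [edist_dist, ← ENNReal.ofReal_div_of_pos h0,
        ENNReal.ofReal_lt_ofReal_iff hM, div_lt_iff₀ h0] at hj
      exact hj
    exact ⟨this.le, fun _ => this⟩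

/-- The points that a feasible relabelling keeps have small sets of steep points. -/
theorem Feasible.card_steepSet_le {n : ℕ} {x : Fin n → Ω} {y : Fin n → Fin 2} {z : Fin n → ℝ}
    {L : ℝ} {X : ℕ → Ω} {Y : ℕ → ℕ} (hX : ∀ i : Fin n, X i = x i)
    (hY : ∀ i : Fin n, Y i = (y i : ℕ)) (hL : 0 < L) (hz : Feasible x L z) {U : Finset ℕ}
    (hU : ∀ i ∈ U, ∃ h : i < n, z ⟨i, h⟩ = ((y ⟨i, h⟩ : ℕ) : ℝ)) {T : ℝ} (hT : 1 ≤ T) :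
    ((steepSet n X Y U (1 / (T * L))).card : ℝ) * T ≤ n := by
  have key : ∀ T : ℝ, 1 ≤ T → T ≤ n + 1 →
      ((steepSet n X Y U (1 / (T * L))).card : ℝ) * T ≤ n := by
    intro T hT hTn
    rw [← le_div_iff₀ (by linarith)]
    refine le_trans (Nat.cast_le.2 ?_) (hz.2 T hT hTn)
    rw [← Set.ncard_image_of_injective _ Fin.val_injective, ← Set.ncard_coe_finset]
    refine Set.ncard_le_ncard ?_ (Set.toFinite _)
    intro i hi
    obtain ⟨hin, u, hu, v, hv, h0, h1, h2⟩ := mem_steepSet.1 hi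
    refine ⟨⟨i, hin⟩, ?_, rfl⟩
    by_contra hlt
    simp only [Set.mem_ofPred_eq, not_le] at hlt
    obtain ⟨hun, hzu⟩ := hU u hu
    obtain ⟨hvn, hzv⟩ := hU v hv
    have hyu : (y ⟨u, hun⟩ : ℕ) = 0 := (hY ⟨u, hun⟩).symm.trans h0
    have hyv : (y ⟨v, hvn⟩ : ℕ) = 1 := by
      have h3 : (y ⟨v, hvn⟩ : ℕ) ≠ 0 := (hY ⟨v, hvn⟩).symm.trans_ne h1
      have := (y ⟨v, hvn⟩).2
      omega
    rw [hyu, Nat.cast_zero] at hzu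
    rw [hyv, Nat.cast_one] at hzv
    obtain ⟨a1, a2⟩ := abs_sub_le_of_slope_lt hlt ⟨u, hun⟩
    obtain ⟨b1, b2⟩ := abs_sub_le_of_slope_lt hlt ⟨v, hvn⟩
    rw [hX ⟨i, hin⟩, hX ⟨u, hun⟩, hX ⟨v, hvn⟩] at h2
    rw [hzu] at a1 a2
    rw [hzv] at b1 b2
    have hTL : 0 < T * L := by positivity
    rw [le_div_iff₀ hTL] at h2
    have tri : 1 ≤ |z ⟨i, hin⟩ - 0| + |z ⟨i, hin⟩ - 1| := by
      have e1 := le_abs_self (z ⟨i, hin⟩ - 0)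
      have e2 := neg_le_abs (z ⟨i, hin⟩ - 1)
      linarith
    -- One positive distance makes the sum of the two label gaps strictly less than `T * L` times a
    -- sum of distances, so less than `1`. If both distances vanish, so do both gaps.
    rcases (dist_nonneg (x := x ⟨i, hin⟩) (y := x ⟨u, hun⟩)).eq_or_lt with hd | hd
    · rcases (dist_nonneg (x := x ⟨i, hin⟩) (y := x ⟨v, hvn⟩)).eq_or_lt with hd' | hd'
      · rw [← hd] at a1
        rw [← hd'] at b1
        linarith
      · have := b2 hd'
        nlinarith
    · have := a2 hd
      nlinarith
  -- The algorithm also uses scales beyond `n + 1`. At `T = n + 1` the bound already forces the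
  -- steep set to be empty, and it shrinks as `T` grows.
  rcases le_or_gt T (n + 1) with hTn | hTn
  · exact key T hT hTn
  · have h1 := key (n + 1) (by simp) le_rfl
    have h2 : (steepSet n X Y U (1 / (((n : ℝ) + 1) * L))).card = 0 := by
      by_contra hne
      have h3 : (1 : ℝ) ≤ ((steepSet n X Y U (1 / (((n : ℝ) + 1) * L))).card : ℝ) := by
        exact_mod_cast Nat.one_le_iff_ne_zero.2 hne
      nlinarith [(Nat.cast_nonneg n : (0 : ℝ) ≤ n)]
    have h4 : (steepSet n X Y U (1 / (T * L))).card = 0 := by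
      refine Nat.le_zero.1 (h2 ▸ card_le_card (steepSet_mono (Subset.refl U) ?_))
      gcongr
    rw [h4]
    simp

/-- `a` is the distance from `i` to the points of `V`, truncated at `M`. -/
structure IsTruncDist (X : ℕ → Ω) (M : ℝ) (V : ℕ → Prop) (i : ℕ) (a : ℝ) : Prop where
  le_bound : a ≤ M
  le_dist : ∀ u, V u → a ≤ dist (X i) (X u)
  attained : a = M ∨ ∃ u, V u ∧ a = dist (X i) (X u)

theorem IsTruncDist.nonneg {X : ℕ → Ω} {M : ℝ} {V : ℕ → Prop} {i : ℕ} {a : ℝ}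
    (h : IsTruncDist X M V i a) (hM : 0 ≤ M) : 0 ≤ a := by
  rcases h.attained with h | ⟨u, -, h⟩
  · exact h ▸ hM
  · exact h ▸ dist_nonneg

/-- The distance to a set is 1-Lipschitz, and truncation preserves this. -/
theorem IsTruncDist.le_add {X : ℕ → Ω} {M : ℝ} {V : ℕ → Prop} {i j : ℕ} {a b : ℝ}
    (h : IsTruncDist X M V i a) (h' : IsTruncDist X M V j b) :
    a ≤ b + dist (X i) (X j) := by
  rcases h'.attained with hb | ⟨u, hu, hb⟩
  · have := h.le_bound
    have := dist_nonneg (x := X i) (y := X j)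
    linarith
  · have := h.le_dist u hu
    have := dist_triangle (X i) (X j) (X u)
    linarith

/-- The numerator of the difference is `(a - a') b' + a' (b' - b)`, at most `δ (a' + b')`. The
factor `a' + b'` cancels, so the Lipschitz constant depends on the first point alone. -/
theorem abs_ratio_sub_le {a b a' b' δ : ℝ} (ha' : 0 ≤ a') (hb' : 0 ≤ b')
    (hs : 0 < a + b) (hs' : 0 < a' + b') (h1 : |a - a'| ≤ δ) (h2 : |b - b'| ≤ δ) :
    |a / (a + b) - a' / (a' + b')| ≤ 1 / (a + b) * δ := by
  have e : a / (a + b) - a' / (a' + b') =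
      ((a - a') * b' + a' * (b' - b)) / ((a + b) * (a' + b')) := by
    field_simp
    ring
  rw [e, abs_div, abs_of_pos (mul_pos hs hs'), div_le_iff₀ (mul_pos hs hs')]
  have e' : 1 / (a + b) * δ * ((a + b) * (a' + b')) = δ * (a' + b') := by
    field_simp
  rw [e']
  calc |(a - a') * b' + a' * (b' - b)| ≤ |a - a'| * b' + a' * |b' - b| := by
        refine (abs_add_le _ _).trans ?_
        rw [abs_mul, abs_mul, abs_of_nonneg ha', abs_of_nonneg hb']
    _ ≤ δ * b' + a' * δ := by
        rw [abs_sub_comm b' b]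
        gcongr
    _ = δ * (a' + b') := by ring

/-- Interpolating between the kept points of either label: the slopes are large only on the set
of steep points. -/
theorem interpolation_bounds {n : ℕ} {x : Fin n → Ω} {y : Fin n → Fin 2} {z : Fin n → ℝ}
    {L b : ℝ} {X : ℕ → Ω} {Y : ℕ → ℕ} (hX : ∀ i : Fin n, X i = x i)
    (hY : ∀ i : Fin n, Y i = (y i : ℕ)) (hL : 0 < L) (hb : 1 < b) {U : Finset ℕ}
    (hU : ∀ t : ℝ, 1 ≤ t → t ≤ (n : ℝ) + 1 →
      ((steepSet n X Y U (1 / (t * (b * L)))).card : ℝ) * t ≤ n) {α β : ℕ → ℝ}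
    (hα : ∀ i < n, IsTruncDist X (1 / L) (fun u => u ∈ U ∧ Y u = 0) i (α i))
    (hβ : ∀ i < n, IsTruncDist X (1 / L) (fun u => u ∈ U ∧ Y u ≠ 0) i (β i))
    (hz : ∀ i : Fin n, z i = α i / (α i + β i)) :
    (∀ i, z i ∈ Set.Icc (0 : ℝ) 1) ∧ (∀ i : Fin n, (i : ℕ) ∈ U → z i = ((y i : ℕ) : ℝ)) ∧
      SlopeBounded x (b * L) z := by
  have hM : 0 < 1 / L := by positivity
  have hα0 : ∀ i < n, 0 ≤ α i := fun i hi => (hα i hi).nonneg hM.le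
  have hβ0 : ∀ i < n, 0 ≤ β i := fun i hi => (hβ i hi).nonneg hM.le
  -- Below `1 / L` neither distance is truncated, as the other one is nonnegative; both are
  -- therefore attained at kept points.
  have mem : ∀ i < n, ∀ r < 1 / L, α i + β i ≤ r → i ∈ steepSet n X Y U r := by
    intro i hi r hr hle
    have h1 := hα0 i hi
    have h2 := hβ0 i hi
    rcases (hα i hi).attained with h | ⟨u, hu, hau⟩
    · linarith
    rcases (hβ i hi).attained with h | ⟨v, hv, hbv⟩
    · linarith
    exact mem_steepSet.2 ⟨hi, u, hu.1, v, hv.1, hu.2, hv.2, by linarith⟩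
  -- A point with `α + β = 0` would be steep at every radius, but the bound at `t = n + 1` leaves no
  -- steep point.
  have hpos : ∀ i < n, 0 < α i + β i := by
    intro i hi
    by_contra hle
    have h1 := mem i hi 0 hM (not_lt.1 hle)
    have h2 := hU (n + 1) (by simp) le_rfl
    have h3 : i ∈ steepSet n X Y U (1 / (((n : ℝ) + 1) * (b * L))) :=
      steepSet_mono (Subset.refl U) (by positivity) h1
    have h4 : (1 : ℝ) ≤ ((steepSet n X Y U (1 / (((n : ℝ) + 1) * (b * L)))).card : ℝ) := by
      exact_mod_cast card_pos.2 ⟨i, h3⟩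
    nlinarith [(Nat.cast_nonneg n : (0 : ℝ) ≤ n)]
  refine ⟨fun i => ?_, fun i hi => ?_, fun t ht htn => ?_⟩
  · rw [hz i]
    have h1 := hα0 i i.2
    have h2 := hβ0 i i.2
    exact ⟨by positivity, (div_le_one (hpos i i.2)).2 (by linarith)⟩
  · rw [hz i]
    have h3 := hpos i i.2
    by_cases h : Y i = 0
    · have : α i = 0 := le_antisymm (by simpa using (hα i i.2).le_dist i ⟨hi, h⟩) (hα0 i i.2)
      rw [this, ← hY i, h]
      simp
    · have h4 : β i = 0 := le_antisymm (by simpa using (hβ i i.2).le_dist i ⟨hi, h⟩) (hβ0 i i.2)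
      have h5 : (y i : ℕ) = 1 := by
        have := (y i).2
        have := hY i
        omega
      rw [h4, add_zero] at h3
      rw [h4, h5, add_zero, div_self h3.ne']
      simp
  · rw [le_div_iff₀ (by linarith)]
    refine le_trans ?_ (hU t ht htn)
    refine mul_le_mul_of_nonneg_right (Nat.cast_le.2 ?_) (by linarith)
    rw [← Set.ncard_image_of_injective _ Fin.val_injective, ← Set.ncard_coe_finset]
    refine Set.ncard_le_ncard ?_ (Finset.finite_toSet _)
    rintro _ ⟨i, hi, rfl⟩
    have hs : slope x z i ≤ ENNReal.ofReal (1 / (α i + β i)) := by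
      refine iSup_le fun j => ENNReal.div_le_of_le_mul ?_
      rw [edist_dist, ← ENNReal.ofReal_mul (by have := hpos i i.2; positivity), hz i, hz j]
      refine ENNReal.ofReal_le_ofReal ?_
      rw [← hX i, ← hX j]
      refine abs_ratio_sub_le (hα0 j j.2) (hβ0 j j.2) (hpos i i.2)
        (hpos j j.2) (abs_sub_le_iff.2 ⟨?_, ?_⟩) (abs_sub_le_iff.2 ⟨?_, ?_⟩)
      · linarith [(hα i i.2).le_add (hα j j.2)]
      · linarith [(hα j j.2).le_add (hα i i.2), dist_comm (X i) (X j)]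
      · linarith [(hβ i i.2).le_add (hβ j j.2)]
      · linarith [(hβ j j.2).le_add (hβ i i.2), dist_comm (X i) (X j)]
    have h1 := (show ENNReal.ofReal (t * (b * L)) ≤ slope x z i from hi).trans hs
    have h2 := hpos i i.2
    rw [ENNReal.ofReal_le_ofReal_iff (by positivity)] at h1
    have h3 : 0 < t * (b * L) := by positivity
    refine mem i i.2 _ ?_ ?_
    · refine one_div_lt_one_div_of_lt hL ?_
      nlinarith [mul_pos (show (0 : ℝ) < b by linarith) hL]
    · rwa [le_div_iff₀ h2, ← le_div_iff₀' h3] at h1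

theorem SlopeBounded.mono {n : ℕ} {x : Fin n → Ω} {z : Fin n → ℝ} {M M' : ℝ}
    (h : SlopeBounded x M z) (hM : M ≤ M') : SlopeBounded x M' z := by
  intro t ht htn
  refine le_trans (Nat.cast_le.2 ?_) (h t ht htn)
  refine Set.ncard_le_ncard (fun i (hi : ENNReal.ofReal (t * M') ≤ slope x z i) => ?_)
    (Set.toFinite _)
  exact le_trans (ENNReal.ofReal_le_ofReal (mul_le_mul_of_nonneg_left hM (by linarith))) hi

/-- Control of the steep sets at the scales `4 ^ i` is control at all scales. -/
theorem card_steepSet_le_of_dyadic {n : ℕ} {X : ℕ → Ω} {Y : ℕ → ℕ} {U : Finset ℕ} {L : ℝ}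
    (hL : 0 < L) (h : ∀ i : ℕ, (4 : ℝ) ^ i ≤ 8 * n + 8 →
      ((steepSet n X Y U (1 / (10 * 4 ^ i * L))).card : ℝ) * 4 ^ i ≤ 2 * n) {t : ℝ} (ht : 1 ≤ t)
    (htn : t ≤ (n : ℝ) + 1) :
    ((steepSet n X Y U (1 / (t * (80 * L)))).card : ℝ) * t ≤ n := by
  -- With `4 ^ i ≤ 8 t < 4 ^ (i + 1)`, the radius `1 / (80 t L)` is at most that of the scale `4 ^
  -- i`, and `t < 4 ^ i / 2` absorbs the factor `2` in the budget `2 n`.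
  obtain ⟨i, hi, hi'⟩ := exists_nat_pow_near (show (1 : ℝ) ≤ 8 * t by linarith)
    (show (1 : ℝ) < 4 by norm_num)
  have h1 := h i (by linarith)
  have h2 : (steepSet n X Y U (1 / (t * (80 * L)))).card ≤
      (steepSet n X Y U (1 / (10 * 4 ^ i * L))).card := by
    refine card_le_card (steepSet_mono (Subset.refl U) ?_)
    refine one_div_le_one_div_of_le (by positivity) ?_
    nlinarith
  have h3 : ((steepSet n X Y U (1 / (t * (80 * L)))).card : ℝ) ≤
      (steepSet n X Y U (1 / (10 * 4 ^ i * L))).card := by exact_mod_cast h2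
  rw [pow_succ] at hi'
  have h4 : (0 : ℝ) ≤ ((steepSet n X Y U (1 / (t * (80 * L)))).card : ℝ) := by positivity
  nlinarith

end Slope

/-! ### Deletions at a single scale -/

section Scale

variable {Ω : Type u} [MetricSpace Ω]

/-- The points `p 0, …, p (cnt - 1)` are pairwise more than `ρ` apart, and every point `i < n` is
within distance `ρ` of the point `p (a i)`, the centre of its cluster. -/
structure Clustering (n : ℕ) (X : ℕ → Ω) (ρ : ℝ) (cnt : ℕ) (p a : ℕ → ℕ) : Prop where
  assign_lt : ∀ i < n, a i < cnt
  near : ∀ i < n, dist (X (p (a i))) (X i) ≤ ρ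
  separated : ∀ j < cnt, ∀ l < cnt, j ≠ l → ρ < dist (X (p j)) (X (p l))

/-- The clusters whose centres are within distance `3 ρ` of the centre of the cluster `j`. -/
noncomputable def neighbours (X : ℕ → Ω) (ρ : ℝ) (cnt : ℕ) (p : ℕ → ℕ) (j : ℕ) : Finset ℕ :=
  {l ∈ range cnt | dist (X (p j)) (X (p l)) ≤ 3 * ρ}

theorem mem_neighbours {X : ℕ → Ω} {ρ : ℝ} {cnt : ℕ} {p : ℕ → ℕ} {j l : ℕ} :
    l ∈ neighbours X ρ cnt p j ↔ l < cnt ∧ dist (X (p j)) (X (p l)) ≤ 3 * ρ := by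
  simp [neighbours]

/-- The number of points of the cluster `j` with property `q`. -/
def clusterCount (n : ℕ) (a : ℕ → ℕ) (q : ℕ → Prop) [DecidablePred q] (j : ℕ) : ℕ :=
  #{i ∈ range n | a i = j ∧ q i}

/-- The cost of exempting a cluster of size `m` with label counts `N₀` and `N₁` in its
neighbourhood is worth it at the rate `τ`, and its size is within the budget `n / T`. -/
def Exempt (n : ℕ) (T τ : ℝ) (m N₀ N₁ : ℕ) : Prop :=
  (m : ℝ) * T ≤ n ∧ τ * m < N₀ ∧ τ * m < N₁

theorem sum_clusterCount {n : ℕ} {a : ℕ → ℕ} (q : ℕ → Prop) [DecidablePred q] (S : Finset ℕ) :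
    ∑ j ∈ S, clusterCount n a q j = #{i ∈ range n | a i ∈ S ∧ q i} := by
  simp only [clusterCount, card_filter]
  rw [sum_comm]
  refine sum_congr rfl fun i _ => ?_
  by_cases hq : q i <;> simp [hq]

/-- The data computed at a single scale: label counts `n₀`, `n₁` of the clusters, label counts
`N₀`, `N₁` of their neighbourhoods, the rate `τ`, and the set `del` of deleted points. -/
structure ScaleData (n : ℕ) (X : ℕ → Ω) (Y : ℕ → ℕ) (ρ T : ℝ) where
  cnt : ℕ
  p : ℕ → ℕ
  a : ℕ → ℕ
  n₀ : ℕ → ℕ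
  n₁ : ℕ → ℕ
  N₀ : ℕ → ℕ
  N₁ : ℕ → ℕ
  τ : ℝ
  del : Finset ℕ
  clustering : Clustering n X ρ cnt p a
  n₀_eq : ∀ j < cnt, n₀ j = clusterCount n a (fun i => Y i = 0) j
  n₁_eq : ∀ j < cnt, n₁ j = clusterCount n a (fun i => Y i ≠ 0) j
  N₀_eq : ∀ j < cnt, N₀ j = ∑ l ∈ neighbours X ρ cnt p j, n₀ l
  N₁_eq : ∀ j < cnt, N₁ j = ∑ l ∈ neighbours X ρ cnt p j, n₁ l
  mem_del : ∀ i, i ∈ del ↔ i < n ∧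
    ((Y i = 0 ∧ ∃ j ∈ neighbours X ρ cnt p (a i),
        ¬ Exempt n T τ (n₀ j + n₁ j) (N₀ j) (N₁ j) ∧ N₀ j ≤ N₁ j) ∨
      (Y i ≠ 0 ∧ ∃ j ∈ neighbours X ρ cnt p (a i),
        ¬ Exempt n T τ (n₀ j + n₁ j) (N₀ j) (N₁ j) ∧ N₁ j < N₀ j))

/-! ### Steepness and optimality of the deletions at one scale -/

namespace ScaleData

variable {n : ℕ} {X : ℕ → Ω} {Y : ℕ → ℕ} {ρ T : ℝ} (S : ScaleData n X Y ρ T)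

open Classical in
/-- The exempt clusters at the rate `τ`. -/
noncomputable def exemptSet (τ : ℝ) : Finset ℕ :=
  {j ∈ range S.cnt | Exempt n T τ (S.n₀ j + S.n₁ j) (S.N₀ j) (S.N₁ j)}

theorem mem_exemptSet {τ : ℝ} {j : ℕ} : j ∈ S.exemptSet τ ↔
    j < S.cnt ∧ Exempt n T τ (S.n₀ j + S.n₁ j) (S.N₀ j) (S.N₁ j) := by
  simp [exemptSet]

/-- The total size of the exempt clusters at the rate `τ`. -/
noncomputable def weight (τ : ℝ) : ℕ :=
  ∑ j ∈ S.exemptSet τ, (S.n₀ j + S.n₁ j)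

/-- The cost of cleaning the neighbourhood of the cluster `j` from one of the labels. -/
def cost (j : ℕ) : ℕ := min (S.N₀ j) (S.N₁ j)

theorem size_eq {j : ℕ} (hj : j < S.cnt) :
    S.n₀ j + S.n₁ j = #{i ∈ range n | S.a i = j} := by
  rw [S.n₀_eq j hj, S.n₁_eq j hj, clusterCount, clusterCount, ← filter_filter, ← filter_filter,
    card_filter_add_card_filter_not]

theorem N₀_eq_card {j : ℕ} (hj : j < S.cnt) :
    S.N₀ j = #{i ∈ range n | S.a i ∈ neighbours X ρ S.cnt S.p j ∧ Y i = 0} := by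
  rw [S.N₀_eq j hj, ← sum_clusterCount]
  exact sum_congr rfl fun l hl => S.n₀_eq l (mem_neighbours.1 hl).1

theorem N₁_eq_card {j : ℕ} (hj : j < S.cnt) :
    S.N₁ j = #{i ∈ range n | S.a i ∈ neighbours X ρ S.cnt S.p j ∧ Y i ≠ 0} := by
  rw [S.N₁_eq j hj, ← sum_clusterCount]
  exact sum_congr rfl fun l hl => S.n₁_eq l (mem_neighbours.1 hl).1

theorem sum_size_eq {O : Finset ℕ} (hO : ∀ j ∈ O, j < S.cnt) :
    ∑ j ∈ O, (S.n₀ j + S.n₁ j) = #{i ∈ range n | S.a i ∈ O} := by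
  rw [sum_congr rfl fun j hj => S.size_eq (hO j hj)]
  have := sum_clusterCount (n := n) (a := S.a) (fun _ => True) O
  simpa [clusterCount] using this

/-- This is why neighbourhoods have radius `3ρ`: going from centre to point, point to point and
point to centre costs `ρ` each. -/
theorem mem_neighbours_of_dist_le {i u : ℕ} (hi : i < n) (hu : u < n)
    (h : dist (X i) (X u) ≤ ρ) : S.a u ∈ neighbours X ρ S.cnt S.p (S.a i) := by
  refine mem_neighbours.2 ⟨S.clustering.assign_lt u hu, ?_⟩
  have h1 := S.clustering.near i hi
  have h2 := S.clustering.near u hu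
  have h3 := dist_triangle4_right (X (S.p (S.a i))) (X (S.p (S.a u))) (X i) (X u)
  linarith

/-- After the deletions, only points of exempt clusters are steep. -/
theorem card_steepSet_le {U : Finset ℕ} (hU : ∀ i ∈ U, i < n ∧ i ∉ S.del) :
    #(steepSet n X Y U ρ) ≤ S.weight S.τ := by
  rw [weight, S.sum_size_eq fun j hj => (S.mem_exemptSet.1 hj).1]
  refine card_le_card fun i hi => ?_
  obtain ⟨hin, u, hu, v, hv, h0, h1, h2⟩ := mem_steepSet.1 hi
  have hu' := hU u hu
  have hv' := hU v hv
  have hiu := S.mem_neighbours_of_dist_le hin hu'.1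
    (by linarith [dist_nonneg (x := X i) (y := X v)])
  have hiv := S.mem_neighbours_of_dist_le hin hv'.1
    (by linarith [dist_nonneg (x := X i) (y := X u)])
  have symm : ∀ {j l}, j < S.cnt → l ∈ neighbours X ρ S.cnt S.p j →
      j ∈ neighbours X ρ S.cnt S.p l := fun hj hl =>
    mem_neighbours.2 ⟨hj, by rw [dist_comm]; exact (mem_neighbours.1 hl).2⟩
  refine mem_filter.2 ⟨mem_range.2 hin, S.mem_exemptSet.2 ⟨S.clustering.assign_lt i hin, ?_⟩⟩
  by_contra hne
  rcases le_or_gt (S.N₀ (S.a i)) (S.N₁ (S.a i)) with hle | hlt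
  · exact hu'.2 ((S.mem_del u).2 ⟨hu'.1, .inl ⟨h0, _,
      symm (S.clustering.assign_lt i hin) hiu, hne, hle⟩⟩)
  · exact hv'.2 ((S.mem_del v).2 ⟨hv'.1, .inr ⟨h1, _,
      symm (S.clustering.assign_lt i hin) hiv, hne, hlt⟩⟩)

/-- The number of deletions is at most the total cost of the clusters that are not exempt. -/
theorem card_del_le : #S.del ≤ ∑ j ∈ range S.cnt \ S.exemptSet S.τ, S.cost j := by
  classical
  have symm : ∀ {j l}, j < S.cnt → l ∈ neighbours X ρ S.cnt S.p j →
      j ∈ neighbours X ρ S.cnt S.p l := fun hj hl =>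
    mem_neighbours.2 ⟨hj, by rw [dist_comm]; exact (mem_neighbours.1 hl).2⟩
  -- The minority points in the neighbourhood of `j`, ties counting label `0` as the minority; there
  -- are `S.cost j` of them.
  let f : ℕ → Finset ℕ := fun j => {i ∈ range n | S.a i ∈ neighbours X ρ S.cnt S.p j ∧
    if S.N₀ j ≤ S.N₁ j then Y i = 0 else Y i ≠ 0}
  have h1 : S.del ⊆ (range S.cnt \ S.exemptSet S.τ).biUnion f := by
    intro i hi
    obtain ⟨hin, h⟩ := (S.mem_del i).1 hi
    have ha := S.clustering.assign_lt i hin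
    rcases h with ⟨hy, j, hj, hne, hle⟩ | ⟨hy, j, hj, hne, hlt⟩
    · refine mem_biUnion.2 ⟨j, mem_sdiff.2 ⟨mem_range.2 (mem_neighbours.1 hj).1,
        fun h => hne (S.mem_exemptSet.1 h).2⟩, mem_filter.2 ⟨mem_range.2 hin, symm ha hj, ?_⟩⟩
      rw [if_pos hle]
      exact hy
    · refine mem_biUnion.2 ⟨j, mem_sdiff.2 ⟨mem_range.2 (mem_neighbours.1 hj).1,
        fun h => hne (S.mem_exemptSet.1 h).2⟩, mem_filter.2 ⟨mem_range.2 hin, symm ha hj, ?_⟩⟩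
      rw [if_neg (not_le.2 hlt)]
      exact hy
  refine (card_le_card h1).trans (card_biUnion_le.trans (sum_le_sum fun j hj => ?_))
  have hj' : j < S.cnt := mem_range.1 (mem_sdiff.1 hj).1
  rw [cost, S.N₀_eq_card hj', S.N₁_eq_card hj']
  by_cases hle : S.N₀ j ≤ S.N₁ j
  · have h2 := hle
    rw [S.N₀_eq_card hj', S.N₁_eq_card hj'] at h2
    simp only [f, if_pos hle]
    rw [min_eq_left h2]
  · have h2 := hle
    rw [S.N₀_eq_card hj', S.N₁_eq_card hj'] at h2
    simp only [f, if_neg hle]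
    rw [min_eq_right (not_le.1 h2).le]

/-- Any set of kept points with few steep points pays, up to the packing constant, the cost of
the clusters that are not steep. -/
theorem exists_steep_clusters {D : ℕ} (hD : DoublingWith Ω D) (hρ : 0 < ρ) (hT : 0 < T)
    {U : Finset ℕ} (hU : ((steepSet n X Y U (10 * ρ)).card : ℝ) * T ≤ n) :
    ∃ O ⊆ range S.cnt, (∀ j ∈ O, ((S.n₀ j + S.n₁ j : ℕ) : ℝ) * T ≤ n) ∧
      ((∑ j ∈ O, (S.n₀ j + S.n₁ j) : ℕ) : ℝ) * T ≤ n ∧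
      ∑ j ∈ range S.cnt \ O, S.cost j ≤ D ^ 3 * #(range n \ U) := by
  classical
  -- The clusters that see kept points of both labels. Each of their points is within `ρ + 3ρ + ρ =
  -- 5ρ` of both, hence `10ρ`-steep.
  let O : Finset ℕ := {j ∈ range S.cnt |
    (∃ u < n, S.a u ∈ neighbours X ρ S.cnt S.p j ∧ Y u = 0 ∧ u ∈ U) ∧
    ∃ v < n, S.a v ∈ neighbours X ρ S.cnt S.p j ∧ Y v ≠ 0 ∧ v ∈ U}
  have hO : O ⊆ range S.cnt := filter_subset _ _
  have key : ∑ j ∈ O, (S.n₀ j + S.n₁ j) ≤ #(steepSet n X Y U (10 * ρ)) := by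
    rw [S.sum_size_eq fun j hj => mem_range.1 (hO hj)]
    refine card_le_card fun i hi => ?_
    obtain ⟨hin, hi⟩ := mem_filter.1 hi
    rw [mem_range] at hin
    obtain ⟨-, ⟨u, hun, hu, hu0, huU⟩, ⟨v, hvn, hv, hv0, hvU⟩⟩ := mem_filter.1 hi
    refine mem_steepSet.2 ⟨hin, u, huU, v, hvU, hu0, hv0, ?_⟩
    have hd : ∀ w < n, S.a w ∈ neighbours X ρ S.cnt S.p (S.a i) → dist (X i) (X w) ≤ 5 * ρ := by
      intro w hw hwi
      have h1 := S.clustering.near i hin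
      have h2 := S.clustering.near w hw
      have h3 := (mem_neighbours.1 hwi).2
      have h4 := dist_triangle4 (X i) (X (S.p (S.a i))) (X (S.p (S.a w))) (X w)
      rw [dist_comm] at h1
      linarith
    linarith [hd u hun hu, hd v hvn hv]
  have hsum : ((∑ j ∈ O, (S.n₀ j + S.n₁ j) : ℕ) : ℝ) * T ≤ n :=
    (mul_le_mul_of_nonneg_right (Nat.cast_le.2 key) hT.le).trans hU
  refine ⟨O, hO, fun j hj => ?_, hsum, ?_⟩
  · refine le_trans (mul_le_mul_of_nonneg_right (Nat.cast_le.2 ?_) hT.le) hsum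
    exact single_le_sum (f := fun j => S.n₀ j + S.n₁ j) (fun _ _ => Nat.zero_le _) hj
  · calc ∑ j ∈ range S.cnt \ O, S.cost j
        ≤ ∑ j ∈ range S.cnt \ O, #{i ∈ range n \ U | S.a i ∈ neighbours X ρ S.cnt S.p j} := by
          refine sum_le_sum fun j hj => ?_
          obtain ⟨hj1, hj2⟩ := mem_sdiff.1 hj
          have hj' := mem_range.1 hj1
          rw [cost, S.N₀_eq_card hj', S.N₁_eq_card hj']
          -- Outside `O` one label has no kept point in the neighbourhood. All points with that
          -- label there are missing from `U`, and they number at least the minimum of the two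
          -- counts.
          by_cases h0 : ∃ u < n, S.a u ∈ neighbours X ρ S.cnt S.p j ∧ Y u = 0 ∧ u ∈ U
          · refine (min_le_right _ _).trans (card_le_card fun i hi => ?_)
            obtain ⟨hi1, hi2, hi3⟩ := mem_filter.1 hi
            refine mem_filter.2 ⟨mem_sdiff.2 ⟨hi1, fun hiU => hj2 ?_⟩, hi2⟩
            exact mem_filter.2 ⟨hj1, h0, i, mem_range.1 hi1, hi2, hi3, hiU⟩
          · refine (min_le_left _ _).trans (card_le_card fun i hi => ?_)
            obtain ⟨hi1, hi2, hi3⟩ := mem_filter.1 hi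
            refine mem_filter.2 ⟨mem_sdiff.2 ⟨hi1, fun hiU => h0 ?_⟩, hi2⟩
            exact ⟨i, mem_range.1 hi1, hi2, hi3, hiU⟩
      _ ≤ ∑ j ∈ range S.cnt, #{i ∈ range n \ U | S.a i ∈ neighbours X ρ S.cnt S.p j} :=
          sum_le_sum_of_subset sdiff_subset
      -- Double counting: a point missing from `U` is charged only by clusters whose centres are
      -- within `3ρ` of its own centre, and packing bounds their number.
      _ = ∑ i ∈ range n \ U, #{j ∈ range S.cnt | S.a i ∈ neighbours X ρ S.cnt S.p j} := by
          simp only [card_filter]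
          exact sum_comm
      _ ≤ #(range n \ U) • D ^ 3 := by
          refine sum_le_card_nsmul _ _ _ fun i _ => ?_
          refine hD.card_le_of_separated _ (fun j => X (S.p j)) (X (S.p (S.a i))) hρ
            (fun j hj => (mem_neighbours.1 (mem_filter.1 hj).2).2) fun j hj l hl hjl => ?_
          exact S.clustering.separated j (mem_range.1 (mem_filter.1 hj).1) l
            (mem_range.1 (mem_filter.1 hl).1) hjl
      _ = D ^ 3 * #(range n \ U) := by rw [smul_eq_mul, mul_comm]

/-- The number of deletions is within a constant factor of optimal if the rate `τ` is so small
that it does not matter, or the rate `τ / 2` is too small. -/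
theorem card_del_le_of_rate {D : ℕ} (hD : DoublingWith Ω D) (hρ : 0 < ρ) (hT : 0 < T)
    (hτ : 0 ≤ S.τ) (hrate : S.τ * n < 1 ∨ 2 * (n : ℝ) < S.weight (S.τ / 2) * T)
    {U : Finset ℕ} (hU : ((steepSet n X Y U (10 * ρ)).card : ℝ) * T ≤ n) :
    #S.del ≤ 3 * D ^ 3 * #(range n \ U) := by
  classical
  obtain ⟨O, hO, hOsize, hOsum, hOcost⟩ := S.exists_steep_clusters hD hρ hT hU
  set E := S.exemptSet S.τ with hE
  set P := D ^ 3 * #(range n \ U) with hP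
  have h1 : ∑ j ∈ range S.cnt \ E, S.cost j ≤ P + ∑ j ∈ O \ E, S.cost j := by
    calc ∑ j ∈ range S.cnt \ E, S.cost j
        ≤ ∑ j ∈ (range S.cnt \ O) ∪ (O \ E), S.cost j := by
          refine sum_le_sum_of_subset fun j hj => ?_
          obtain ⟨a, b⟩ := mem_sdiff.1 hj
          by_cases hjO : j ∈ O
          · exact mem_union_right _ (mem_sdiff.2 ⟨hjO, b⟩)
          · exact mem_union_left _ (mem_sdiff.2 ⟨a, hjO⟩)
      _ ≤ ∑ j ∈ range S.cnt \ O, S.cost j + ∑ j ∈ O \ E, S.cost j := by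
          rw [← sum_union_inter]
          exact Nat.le_add_right _ _
      _ ≤ _ := Nat.add_le_add_right hOcost _
  -- A cluster of `O` satisfies the size condition of `Exempt`, so it can fail to be exempt only
  -- because its cost is at most `τ` per point.
  have h2 : ∀ j ∈ O \ E, (S.cost j : ℝ) ≤ S.τ * ((S.n₀ j + S.n₁ j : ℕ) : ℝ) := by
    intro j hj
    obtain ⟨hjO, hjE⟩ := mem_sdiff.1 hj
    by_contra hlt
    rw [cost, Nat.cast_min, not_le, lt_min_iff] at hlt
    exact hjE (S.mem_exemptSet.2 ⟨mem_range.1 (hO hjO), hOsize j hjO, hlt.1, hlt.2⟩)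
  have h3 : (∑ j ∈ O \ E, S.cost j : ℕ) ≤ 2 * P := by
    rcases hrate with hr | hr
    -- If `τ n < 1`, these costs are natural numbers less than `1`, hence zero.
    · rw [sum_eq_zero fun j hj => ?_]
      · exact Nat.zero_le _
      · have h4 := h2 j hj
        have h5 : ((S.n₀ j + S.n₁ j : ℕ) : ℝ) ≤ n := by
          rw [S.size_eq (mem_range.1 (hO (mem_sdiff.1 hj).1))]
          exact_mod_cast (card_filter_le _ _).trans (card_range n).le
        have h6 : (S.cost j : ℝ) < 1 := by nlinarith
        exact Nat.lt_one_iff.1 (by exact_mod_cast h6)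
    · have h4 : (∑ j ∈ O \ E, S.cost j : ℕ) * T ≤ S.τ * n := by
        have : ((∑ j ∈ O \ E, S.cost j : ℕ) : ℝ) ≤
            S.τ * ((∑ j ∈ O, (S.n₀ j + S.n₁ j) : ℕ) : ℝ) := by
          rw [Nat.cast_sum, Nat.cast_sum, mul_sum]
          refine (sum_le_sum h2).trans (sum_le_sum_of_subset_of_nonneg sdiff_subset ?_)
          intro j _ _
          positivity
        calc _ ≤ S.τ * ((∑ j ∈ O, (S.n₀ j + S.n₁ j) : ℕ) : ℝ) * T :=
              mul_le_mul_of_nonneg_right this hT.le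
          _ = S.τ * (((∑ j ∈ O, (S.n₀ j + S.n₁ j) : ℕ) : ℝ) * T) := by ring
          _ ≤ S.τ * n := mul_le_mul_of_nonneg_left hOsum hτ
      have h5 : S.weight (S.τ / 2) ≤ ∑ j ∈ S.exemptSet (S.τ / 2) \ O, (S.n₀ j + S.n₁ j) +
          ∑ j ∈ O, (S.n₀ j + S.n₁ j) := by
        rw [weight, ← sum_inter_add_sum_sdiff (S.exemptSet (S.τ / 2)) O, add_comm]
        exact Nat.add_le_add_left (sum_le_sum_of_subset inter_subset_right) _
      have h6 : S.τ / 2 * ((∑ j ∈ S.exemptSet (S.τ / 2) \ O, (S.n₀ j + S.n₁ j) : ℕ) : ℝ) ≤ P := by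
        have h7 : ((∑ j ∈ S.exemptSet (S.τ / 2) \ O, S.cost j : ℕ) : ℝ) ≤ P := by
          refine Nat.cast_le.2 (le_trans (sum_le_sum_of_subset ?_) hOcost)
          intro j hj
          obtain ⟨a, b⟩ := mem_sdiff.1 hj
          exact mem_sdiff.2 ⟨mem_range.2 (S.mem_exemptSet.1 a).1, b⟩
        refine le_trans ?_ h7
        rw [Nat.cast_sum, Nat.cast_sum, mul_sum]
        refine sum_le_sum fun j hj => ?_
        have h8 := (S.mem_exemptSet.1 (mem_sdiff.1 hj).1).2
        rw [cost, Nat.cast_min]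
        exact le_min h8.2.1.le h8.2.2.le
      have h7 : (S.weight (S.τ / 2) : ℝ) ≤
          ((∑ j ∈ S.exemptSet (S.τ / 2) \ O, (S.n₀ j + S.n₁ j) : ℕ) : ℝ) +
          ((∑ j ∈ O, (S.n₀ j + S.n₁ j) : ℕ) : ℝ) := by exact_mod_cast h5
      -- Of the weight exceeding `2 n / T` at the rate `τ / 2`, at most `n / T` lies in `O`. The
      -- rest is paid for by the optimum at more than `τ / 2` per point.
      have h8 : (n : ℝ) <
          ((∑ j ∈ S.exemptSet (S.τ / 2) \ O, (S.n₀ j + S.n₁ j) : ℕ) : ℝ) * T := by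
        have := mul_le_mul_of_nonneg_right h7 hT.le
        linarith
      have h9 : ((∑ j ∈ O \ E, S.cost j : ℕ) : ℝ) * T ≤ 2 * P * T := by
        have e1 := mul_le_mul_of_nonneg_left h8.le hτ
        have e2 := mul_le_mul_of_nonneg_right h6 hT.le
        linarith
      exact_mod_cast le_of_mul_le_mul_right h9 hT
  have h4 := S.card_del_le
  rw [← hE] at h4
  calc #S.del ≤ P + 2 * P := by omega
    _ = 3 * D ^ 3 * #(range n \ U) := by rw [hP]; ring

end ScaleData

end Scale

/-! ### Sums over neighbouring clusters -/

section NeighbourSum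

variable {Ω : Type u} [MetricSpace Ω]

/-- For every cluster, add up the entries of the array `b` over the neighbouring clusters, and
store the sums in the array `c`. Two clusters whose centres are older than the current scale are
not neighbours, so that the inner loop can skip them. -/
def neighbourSum (b c : ℕ) : Program :=
  .seq (.setNat 1 (.const 0)) <| forLoop 1 3 <|
    .seq (.ite (.natLt (.var 1) (.var 4))
      (.seq (.setNat 2 (.var 4)) (.setNat 6 (.get b (.var 1))))
      (.seq (.setNat 2 (.const 0)) (.setNat 6 (.const 0)))) <|
    .seq (forLoop 2 3 <|
      .ite (.realLe (.dist (.get 1 (.var 1)) (.get 1 (.var 2)))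
          (.mul (.ofNat (.const 3)) (.var 1)))
        (.setNat 6 (.add (.var 6) (.get b (.var 2))))
        .skip) <|
    .putNat c (.var 1) (.var 6)

theorem sum_neighbours_zero (X : ℕ → Ω) (ρ : ℝ) (p : ℕ → ℕ) (j : ℕ) (f : ℕ → ℕ) :
    ∑ l ∈ neighbours X ρ 0 p j, f l = 0 := by
  simp [neighbours]

theorem sum_neighbours_succ (X : ℕ → Ω) (ρ : ℝ) (k : ℕ) (p : ℕ → ℕ) (j : ℕ) (f : ℕ → ℕ) :
    ∑ l ∈ neighbours X ρ (k + 1) p j, f l = ∑ l ∈ neighbours X ρ k p j, f l +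
      if dist (X (p j)) (X (p k)) ≤ 3 * ρ then f k else 0 := by
  simp only [neighbours, sum_filter, sum_range_succ]

/-- An old centre has no old neighbour but itself, so the inner loop may start from its own entry
and skip the old centres. -/
theorem sum_neighbours_of_separated {X : ℕ → Ω} {ρ : ℝ} (hρ : 0 ≤ ρ) {old : ℕ} {p : ℕ → ℕ}
    (hsep : ∀ j < old, ∀ l < old, j ≠ l → 3 * ρ < dist (X (p j)) (X (p l))) {j : ℕ}
    (hj : j < old) (f : ℕ → ℕ) : ∑ l ∈ neighbours X ρ old p j, f l = f j := by
  have : neighbours X ρ old p j = {j} := by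
    ext l
    rw [mem_neighbours, mem_singleton]
    refine ⟨fun ⟨hl, h⟩ => by_contra fun hne => ?_, ?_⟩
    · exact absurd h (not_le.2 (hsep j hj l hl (Ne.symm hne)))
    · rintro rfl
      exact ⟨hj, by rw [dist_self]; positivity⟩
  rw [this, sum_singleton]

/-- An old cluster scans the new ones only, a new cluster scans all. The quadratic work is thereby
proportional to `cnt - old`, which telescopes over the scales. -/
theorem wp_neighbourSum {d : ℕ → ℕ → ℝ} {X : ℕ → Ω} {n : ℕ}
    (hd : ∀ i < n, ∀ j < n, d i j = dist (X i) (X j)) {b c : ℕ} (hbc : b ≠ c) (hc : c ≠ 1)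
    {s : State} {cnt old : ℕ} {ρ : ℝ} {p : ℕ → ℕ} (hcnt : s.natVar 3 = cnt)
    (hold : s.natVar 4 = old) (hle : old ≤ cnt) (hcn : cnt ≤ n) (hs : s.realVar 1 = ρ) (hρ : 0 ≤ ρ)
    (hp : s.natArr 1 = p) (hpn : ∀ j < cnt, p j < n)
    (hsep : ∀ j < old, ∀ l < old, j ≠ l → 3 * ρ < dist (X (p j)) (X (p l))) :
    WP d (neighbourSum b c) s fun T s' => T ≤ 40 * n + 60 * n * (cnt - old) + 6 ∧
      ∀ j < cnt, s'.natArr c j = ∑ l ∈ neighbours X ρ cnt p j, s.natArr b l := by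
  refine .seq (.setNat ?_)
  refine WP.for (fun k t s' => t ≤ k * (32 + 25 * (cnt - old)) + (k - old) * (25 * cnt) ∧
    ∀ j < k, s'.natArr c j = ∑ l ∈ neighbours X ρ cnt p j, s.natArr b l) (k₀ := 0) (N := cnt)
    rfl rfl (by decide) rfl hcnt (by omega) ⟨by simp, by simp⟩ ?_ ?_
  · rintro k t s₁ hF - hk hk1 ⟨ht, hI⟩
    have f3 : s₁.natVar 3 = cnt := (hF.natVar 3 rfl).trans hcnt
    have f4 : s₁.natVar 4 = old := (hF.natVar 4 rfl).trans hold
    have fρ : s₁.realVar 1 = ρ := (hF.realVar 1 rfl).trans hs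
    have fp : s₁.natArr 1 = p :=
      (hF.natArr 1 (by simp [forLoop, Program.writesNatArr, hc])).trans hp
    have fb : s₁.natArr b = s.natArr b :=
      hF.natArr b (by simp [forLoop, Program.writesNatArr, hbc.symm])
    refine .seq ?_
    -- Both branches continue with the same scan; they differ in its start `k₀`, the accumulator and
    -- the time `T₀` spent so far.
    have inner : ∀ k₀ ≤ cnt, ∀ T₀, ∀ s₂ : State, s₂.natVar 1 = k → s₂.natVar 2 = k₀ →
        s₂.natVar 3 = cnt → s₂.natVar 6 = ∑ l ∈ neighbours X ρ k₀ p k, s.natArr b l →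
        s₂.realVar = s₁.realVar → s₂.natArr = s₁.natArr →
        t + T₀ + (cnt - k₀) * 25 + 20 ≤
          (k + 1) * (32 + 25 * (cnt - old)) + (k + 1 - old) * (25 * cnt) →
        WP d (.seq (forLoop 2 3 <|
          .ite (.realLe (.dist (.get 1 (.var 1)) (.get 1 (.var 2)))
            (.mul (.ofNat (.const 3)) (.var 1)))
          (.setNat 6 (.add (.var 6) (.get b (.var 2)))) .skip) <|
          .putNat c (.var 1) (.var 6)) s₂ fun T s' =>
            t + (T₀ + T) + 8 ≤ (k + 1) * (32 + 25 * (cnt - old)) + (k + 1 - old) * (25 * cnt) ∧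
            ∀ j < k + 1, s'.natArr c j = ∑ l ∈ neighbours X ρ cnt p j, s.natArr b l := by
      intro k₀ hk₀ T₀ s₂ g1 g2 g3 g6 gr ga hT
      refine .seq ?_
      refine WP.for_const (fun m s' => s'.natVar 6 = ∑ l ∈ neighbours X ρ m p k, s.natArr b l) 17
        rfl rfl (by decide) g2 g3 hk₀ g6 ?_ ?_
      · intro m s₃ hF₃ hm hmc hm2 hI₃
        have e1 : s₃.natVar 1 = k := (hF₃.natVar 1 rfl).trans g1
        have ea : s₃.natArr = s₁.natArr := by
          rw [← ga]; funext a; exact hF₃.natArr a rfl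
        have eρ : s₃.realVar 1 = ρ := by rw [hF₃.realVar 1 rfl, gr, fρ]
        refine .ite (fun hb => .setNat ?_) (fun hb => .skip ?_)
        all_goals
          simp only [Test.Holds, RealExpr.eval, NatExpr.eval, e1, ea, fp, hm2, eρ,
            hd _ (hpn k hk) _ (hpn m hmc), Nat.cast_ofNat] at hb
        · refine ⟨by simp [Test.cost, RealExpr.cost, NatExpr.cost], ?_⟩
          simp [NatExpr.eval, hI₃, ea, fb, hm2, sum_neighbours_succ, hb]
        · refine ⟨by simp [Test.cost, RealExpr.cost, NatExpr.cost], ?_⟩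
          simp [hI₃, sum_neighbours_succ, hb]
      · intro T s₃ hF₃ hT₃ hI₃
        have e1 : s₃.natVar 1 = k := (hF₃.natVar 1 rfl).trans g1
        have ea : s₃.natArr = s₁.natArr := by
          rw [← ga]; funext a; exact hF₃.natArr a rfl
        refine .putNat ⟨?_, ?_⟩
        · simp only [NatExpr.cost]
          omega
        · intro j hj
          simp only [NatExpr.eval, e1, hI₃, writeArr_same, ea]
          rcases Nat.lt_succ_iff_lt_or_eq.1 hj with hj | rfl
          · rw [Function.update_of_ne hj.ne, hI j hj]
          · rw [Function.update_self]
    have hmul : (k + 1) * (32 + 25 * (cnt - old)) =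
        k * (32 + 25 * (cnt - old)) + (32 + 25 * (cnt - old)) := by ring
    refine .ite (fun hb => .seq (.setNat (.setNat ?_))) (fun hb => .seq (.setNat (.setNat ?_)))
    all_goals simp only [Test.Holds, NatExpr.eval, hk1, f4] at hb
    · refine inner old hle _ _ (by simpa using hk1) (by simpa [NatExpr.eval] using f4)
        (by simpa using f3) ?_ rfl rfl ?_
      · rw [sum_neighbours_of_separated hρ hsep hb]
        simp [NatExpr.eval, hk1, fb]
      · have := Nat.mul_le_mul_right (25 * cnt) (show k - old ≤ k + 1 - old by omega)
        simp only [Test.cost, NatExpr.cost]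
        omega
    · refine inner 0 (by omega) _ _ (by simpa using hk1) (by simp [NatExpr.eval])
        (by simpa using f3) (by simp [NatExpr.eval, sum_neighbours_zero]) rfl rfl ?_
      have : (k + 1 - old) * (25 * cnt) = (k - old) * (25 * cnt) + 25 * cnt := by
        rw [show k + 1 - old = (k - old) + 1 by omega]
        ring
      simp only [Test.cost, NatExpr.cost]
      omega
  · rintro t s' hF ⟨ht, hI⟩
    refine ⟨?_, hI⟩
    have h1 : cnt * (32 + 25 * (cnt - old)) ≤ n * (32 + 25 * (cnt - old)) :=
      Nat.mul_le_mul_right _ hcn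
    have h2 : (cnt - old) * (25 * cnt) ≤ (cnt - old) * (25 * n) :=
      Nat.mul_le_mul_left _ (by omega)
    have h3 : n * (32 + 25 * (cnt - old)) + (cnt - old) * (25 * n) =
      32 * n + 50 * (n * (cnt - old)) := by ring
    have h4 : 60 * n * (cnt - old) = 60 * (n * (cnt - old)) := by ring
    simp only [NatExpr.cost]
    omega

end NeighbourSum

/-! ### Refinement of the net -/

section Net

variable {Ω : Type u} [MetricSpace Ω]

/-- The first `cnt` entries of `p` are points at pairwise distance more than `R`, and `D i` is the
distance of the point `i` to this set, truncated at `M`; unless it is `M`, it is attained by the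
centre with number `a i`. -/
structure IsNet (n : ℕ) (X : ℕ → Ω) (M R : ℝ) (cnt : ℕ) (p a : ℕ → ℕ) (D : ℕ → ℝ) : Prop where
  centre_lt : ∀ j < cnt, p j < n
  separated : ∀ j < cnt, ∀ l < cnt, j ≠ l → R < dist (X (p j)) (X (p l))
  le_dist : ∀ i < n, ∀ j < cnt, D i ≤ dist (X (p j)) (X i)
  attained : ∀ i < n, D i = M ∨ a i < cnt ∧ dist (X (p (a i))) (X i) ≤ D i

/-- Separation makes `p` injective on the centre numbers. This bound turns the cost per new centre
into `O(n²)` overall. -/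
theorem IsNet.cnt_le {n : ℕ} {X : ℕ → Ω} {M R : ℝ} {cnt : ℕ} {p a : ℕ → ℕ} {D : ℕ → ℝ}
    (h : IsNet n X M R cnt p a D) (hR : 0 ≤ R) : cnt ≤ n := by
  have := card_le_card_of_injOn (s := range cnt) (t := range n) p
    (fun j hj => by simpa using h.centre_lt j (by simpa using hj)) fun j hj l hl hjl => by
      by_contra hne
      have h1 := h.separated j (by simpa using hj) l (by simpa using hl) hne
      rw [hjl, dist_self] at h1
      linarith
  simpa using this

/-- Make the point with the number stored in the variable `1` the next centre. -/
def addCentre : Program :=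
  .seq (.putNat 1 (.var 3) (.var 1)) <|
  .seq (.setNat 2 (.const 0)) <|
  .seq (forLoop 2 0 <|
    .ite (.realLt (.dist (.var 1) (.var 2)) (.get 1 (.var 2)))
      (.seq (.putReal 1 (.var 2) (.dist (.var 1) (.var 2))) (.putNat 2 (.var 2) (.var 3)))
      .skip) <|
  .setNat 3 (.add (.var 3) (.const 1))

/-- Add points as centres until all points are within the distance stored in the real variable
`1` of the set of centres. -/
def refineNet : Program :=
  .seq (.setNat 4 (.var 3)) <|
  .seq (.setNat 1 (.const 0)) <|
  forLoop 1 0 <| .ite (.realLt (.var 1) (.get 1 (.var 1))) addCentre .skip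

variable {d : ℕ → ℕ → ℝ} {X : ℕ → Ω} {n : ℕ}

/-- Since `D i` bounds the distances to the centres from below, `R < D i` is exactly what makes `i`
admissible as a new centre. The last two conclusions let a single sweep over the points suffice. -/
theorem wp_addCentre (hd : ∀ i < n, ∀ j < n, d i j = dist (X i) (X j)) {s : State} {M R : ℝ}
    {i cnt : ℕ} {p a : ℕ → ℕ} {D : ℕ → ℝ} (hn : s.natVar 0 = n) (hi : s.natVar 1 = i) (hin : i < n)
    (hcnt : s.natVar 3 = cnt) (hp : s.natArr 1 = p) (ha : s.natArr 2 = a) (hD : s.realArr 1 = D)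
    (hnet : IsNet n X M R cnt p a D) (hR : R < D i) :
    WP d addCentre s fun T s' => T ≤ 30 * n + 20 ∧ s'.natVar 3 = cnt + 1 ∧
      IsNet n X M R (cnt + 1) (s'.natArr 1) (s'.natArr 2) (s'.realArr 1) ∧
      (∀ j < cnt, s'.natArr 1 j = p j) ∧ (∀ w < n, s'.realArr 1 w ≤ D w) ∧
      s'.realArr 1 i ≤ 0 := by
  refine .seq (.putNat (.seq (.setNat (.seq ?_))))
  refine WP.for_const (fun k s' =>
    (∀ w < k, s'.realArr 1 w = min (D w) (dist (X i) (X w)) ∧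
      s'.natArr 2 w = if dist (X i) (X w) < D w then cnt else a w) ∧
    ∀ w, k ≤ w → s'.realArr 1 w = D w ∧ s'.natArr 2 w = a w) (k₀ := 0) (N := n) 16
    rfl rfl (by decide) rfl (by simpa using hn) (by omega) ⟨by simp, ?_⟩ ?_ ?_
  · intro w _
    simp [hD, writeArr_ne, ha]
  · rintro k s₁ hF - hkn hk ⟨hlt, hge⟩
    have e1 : s₁.natVar 1 = i := by
      rw [hF.natVar 1 rfl]
      simpa using hi
    have e3 : s₁.natVar 3 = cnt := by
      rw [hF.natVar 3 rfl]
      simpa using hcnt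
    have step : ∀ (D' : ℕ → ℝ) (a' : ℕ → ℕ) (δ : ℝ) (c : ℕ),
        D' = Function.update (s₁.realArr 1) k δ → a' = Function.update (s₁.natArr 2) k c →
        δ = min (D k) (dist (X i) (X k)) → c = (if dist (X i) (X k) < D k then cnt else a k) →
        (∀ w < k + 1, D' w = min (D w) (dist (X i) (X w)) ∧
          a' w = if dist (X i) (X w) < D w then cnt else a w) ∧
        ∀ w, k + 1 ≤ w → D' w = D w ∧ a' w = a w := by
      rintro _ _ _ _ rfl rfl rfl rfl
      refine ⟨fun w hw => ?_, fun w hw => ?_⟩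
      · rcases Nat.lt_succ_iff_lt_or_eq.1 hw with hw | rfl
        · simpa [hw.ne] using hlt w hw
        · simp
      · simpa [show w ≠ k by omega] using hge w (by omega)
    refine .ite (fun hb => .seq (.putReal (.putNat ?_))) (fun hb => .skip ?_)
    all_goals
      simp only [Test.Holds, RealExpr.eval, NatExpr.eval, e1, hk, hd _ hin _ hkn,
        (hge k le_rfl).1] at hb
    · refine ⟨by simp [Test.cost, RealExpr.cost, NatExpr.cost], ?_⟩
      refine step _ _ (dist (X i) (X k)) cnt ?_ ?_ (min_eq_right hb.le).symm (if_pos hb).symm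
      · simp [writeArr_same, RealExpr.eval, NatExpr.eval, e1, hk, hd _ hin _ hkn]
      · simp [writeArr_same, NatExpr.eval, hk, e3]
    · refine ⟨by simp [Test.cost, RealExpr.cost, NatExpr.cost], ?_⟩
      refine step _ _ (D k) (a k) ?_ ?_ (min_eq_left (not_lt.1 hb)).symm (if_neg hb).symm
      · rw [← (hge k le_rfl).1, Function.update_eq_self]
      · rw [← (hge k le_rfl).2, Function.update_eq_self]
  · rintro T s₁ hF hT ⟨hlt, -⟩
    have e3 : s₁.natVar 3 = cnt := by
      rw [hF.natVar 3 rfl]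
      simpa using hcnt
    have ep : s₁.natArr 1 = Function.update p cnt i := by
      rw [hF.natArr 1 rfl]
      simp [writeArr_same, NatExpr.eval, hp, hcnt, hi]
    have hpj : ∀ j < cnt, s₁.natArr 1 j = p j := fun j hj => by rw [ep]; simp [hj.ne]
    have hpc : s₁.natArr 1 cnt = i := by rw [ep]; simp
    refine .setNat ⟨?_, by simp [NatExpr.eval, e3], ⟨?_, ?_, ?_, ?_⟩, hpj, ?_, ?_⟩
    · simp only [NatExpr.cost]
      omega
    · intro j hj
      rcases Nat.lt_succ_iff_lt_or_eq.1 hj with hj | rfl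
      · exact (hpj j hj).trans_lt (hnet.centre_lt j hj)
      · exact hpc.trans_lt hin
    · have old : ∀ j < cnt, R < dist (X (p j)) (X i) := fun j hj =>
        hR.trans_le (hnet.le_dist i hin j hj)
      intro j hj l hl hjl
      change R < dist (X (s₁.natArr 1 j)) (X (s₁.natArr 1 l))
      rcases Nat.lt_succ_iff_lt_or_eq.1 hj with hj | rfl
      · rcases Nat.lt_succ_iff_lt_or_eq.1 hl with hl | rfl
        · rw [hpj j hj, hpj l hl]
          exact hnet.separated j hj l hl hjl
        · rw [hpj j hj, hpc]
          exact old j hj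
      · rcases Nat.lt_succ_iff_lt_or_eq.1 hl with hl | rfl
        · rw [hpj l hl, hpc, dist_comm]
          exact old l hl
        · exact absurd rfl hjl
    · intro w hw j hj
      change s₁.realArr 1 w ≤ dist (X (s₁.natArr 1 j)) (X w)
      rw [(hlt w hw).1]
      rcases Nat.lt_succ_iff_lt_or_eq.1 hj with hj | rfl
      · rw [hpj j hj]
        exact (min_le_left _ _).trans (hnet.le_dist w hw j hj)
      · rw [hpc]
        exact min_le_right _ _
    · intro w hw
      change s₁.realArr 1 w = M ∨ s₁.natArr 2 w < cnt + 1 ∧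
        dist (X (s₁.natArr 1 (s₁.natArr 2 w))) (X w) ≤ s₁.realArr 1 w
      rw [(hlt w hw).1, (hlt w hw).2]
      split_ifs with h
      · refine .inr ⟨Nat.lt_succ_self _, ?_⟩
        rw [hpc, min_eq_right h.le]
      · rw [min_eq_left (not_lt.1 h)]
        rcases hnet.attained w hw with h' | ⟨h1, h2⟩
        · exact .inl h'
        · refine .inr ⟨h1.trans (Nat.lt_succ_self _), ?_⟩
          rwa [hpj _ h1]
    · intro w hw
      exact (hlt w hw).1.trans_le (min_le_left _ _)
    · exact (hlt i hin).1.trans_le ((min_le_right _ _).trans (dist_self _).le)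

/-- Greedy sweep: truncated distances never increase, so a point found covered or made a centre
stays covered. Only added centres cost `O(n)`; other points cost `O(1)`. -/
theorem wp_refineNet (hd : ∀ i < n, ∀ j < n, d i j = dist (X i) (X j)) {s : State} {M R ρ : ℝ}
    {cnt : ℕ} {p : ℕ → ℕ} (hn : s.natVar 0 = n) (hcnt : s.natVar 3 = cnt) (hs : s.realVar 1 = ρ)
    (hρ : 0 ≤ ρ) (hρR : ρ ≤ R) (hρM : ρ < M) (hp : s.natArr 1 = p)
    (hnet : IsNet n X M R cnt p (s.natArr 2) (s.realArr 1)) :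
    WP d refineNet s fun T s' => s'.natVar 4 = cnt ∧ cnt ≤ s'.natVar 3 ∧
      T ≤ 50 * n * (s'.natVar 3 - cnt) + 20 * n + 10 ∧
      IsNet n X M ρ (s'.natVar 3) (s'.natArr 1) (s'.natArr 2) (s'.realArr 1) ∧
      Clustering n X ρ (s'.natVar 3) (s'.natArr 1) (s'.natArr 2) ∧
      ∀ j < cnt, s'.natArr 1 j = p j := by
  refine .seq (.setNat (.seq (.setNat ?_)))
  refine WP.for (fun k t s' => cnt ≤ s'.natVar 3 ∧
    IsNet n X M ρ (s'.natVar 3) (s'.natArr 1) (s'.natArr 2) (s'.realArr 1) ∧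
    (∀ j < cnt, s'.natArr 1 j = p j) ∧ (∀ w < k, w < n → s'.realArr 1 w ≤ ρ) ∧
    t ≤ 50 * n * (s'.natVar 3 - cnt) + 20 * k) (k₀ := 0) (N := n)
    rfl rfl (by decide) rfl (by simpa using hn) (by omega) ?_ ?_ ?_
  · refine ⟨by simp [hcnt], ?_, by simp [hp], by simp, by simp⟩
    simp only [hp, Function.update_apply]
    norm_num
    rw [hcnt]
    exact ⟨hnet.centre_lt, fun j hj l hl h => hρR.trans_lt (hnet.separated j hj l hl h),
      hnet.le_dist, hnet.attained⟩
  · rintro k t s₁ hF - hkn hk ⟨hc, hN, hpj, hle, ht⟩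
    have e0 : s₁.natVar 0 = n := by
      rw [hF.natVar 0 rfl]
      simpa using hn
    have eρ : s₁.realVar 1 = ρ := (hF.realVar 1 rfl).trans hs
    refine .ite (fun hb => ?_) (fun hb => .skip ?_)
    all_goals simp only [Test.Holds, RealExpr.eval, NatExpr.eval, eρ, hk] at hb
    · refine (wp_addCentre hd e0 hk hkn rfl rfl rfl rfl hN hb).mono ?_
      rintro T s₂ - ⟨hT, h3, hN', hpj', hle', hk'⟩
      have h3' : Function.update s₂.natVar 1 (k + 1) 3 = s₁.natVar 3 + 1 := by simpa using h3
      refine ⟨?_, ?_, ?_, ?_, ?_⟩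
      · simp only [h3']
        omega
      · simpa only [h3'] using hN'
      · intro j hj
        exact (hpj' j (by omega)).trans (hpj j hj)
      · intro w hw hwn
        rcases Nat.lt_succ_iff_lt_or_eq.1 hw with hw | rfl
        · exact (hle' w hwn).trans (hle w hw hwn)
        · exact hk'.trans hρ
      · simp only [h3']
        have e : 50 * n * (s₁.natVar 3 + 1 - cnt) = 50 * n * (s₁.natVar 3 - cnt) + 50 * n := by
          rw [show s₁.natVar 3 + 1 - cnt = (s₁.natVar 3 - cnt) + 1 by omega]
          ring
        simp only [Test.cost, RealExpr.cost, NatExpr.cost]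
        omega
    · have h3' : Function.update s₁.natVar 1 (k + 1) 3 = s₁.natVar 3 := by simp
      simp only [h3']
      refine ⟨hc, hN, hpj, ?_, ?_⟩
      · intro w hw hwn
        rcases Nat.lt_succ_iff_lt_or_eq.1 hw with hw | rfl
        · exact hle w hw hwn
        · exact not_lt.1 hb
      · simp only [Test.cost, RealExpr.cost, NatExpr.cost]
        omega
  · rintro t s₁ hF ⟨hc, hN, hpj, hle, ht⟩
    refine ⟨?_, hc, ?_, hN, ⟨?_, ?_, hN.separated⟩, hpj⟩
    · rw [hF.natVar 4 rfl]
      simpa [NatExpr.eval] using hcnt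
    · simp only [NatExpr.cost]
      omega
    · intro i hi
      -- The truncation value `M` is excluded because `D i ≤ ρ < M` after the sweep.
      rcases hN.attained i hi with h | h
      · linarith [hle i hi hi]
      · exact h.1
    · intro i hi
      rcases hN.attained i hi with h | h
      · linarith [hle i hi hi]
      · exact h.2.trans (hle i hi hi)

end Net

/-! ### Label counts of the clusters -/

section Count

/-- Count the points with either label in each cluster. -/
def countLabels : Program :=
  .seq (.setNat 1 (.const 0)) <|
  .seq (forLoop 1 3 (.seq (.putNat 3 (.var 1) (.const 0)) (.putNat 4 (.var 1) (.const 0)))) <|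
  .seq (.setNat 1 (.const 0)) <|
  forLoop 1 0 <| .ite (.natEq (.get 0 (.var 1)) (.const 0))
    (.putNat 3 (.get 2 (.var 1)) (.add (.get 3 (.get 2 (.var 1))) (.const 1)))
    (.putNat 4 (.get 2 (.var 1)) (.add (.get 4 (.get 2 (.var 1))) (.const 1)))

theorem clusterCount_zero (a : ℕ → ℕ) (q : ℕ → Prop) [DecidablePred q] (j : ℕ) :
    clusterCount 0 a q j = 0 := by
  simp [clusterCount]

theorem clusterCount_succ (k : ℕ) (a : ℕ → ℕ) (q : ℕ → Prop) [DecidablePred q] (j : ℕ) :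
    clusterCount (k + 1) a q j = clusterCount k a q j + if a k = j ∧ q k then 1 else 0 := by
  simp only [clusterCount, card_filter, sum_range_succ]

theorem wp_countLabels {d : ℕ → ℕ → ℝ} {n : ℕ} {s : State} {cnt : ℕ} {Y a : ℕ → ℕ}
    (hn : s.natVar 0 = n) (hcnt : s.natVar 3 = cnt) (hcn : cnt ≤ n) (hY : s.natArr 0 = Y)
    (ha : s.natArr 2 = a) :
    WP d countLabels s fun T s' => T ≤ 40 * n + 20 ∧
      (∀ j < cnt, s'.natArr 3 j = clusterCount n a (fun i => Y i = 0) j) ∧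
      ∀ j < cnt, s'.natArr 4 j = clusterCount n a (fun i => Y i ≠ 0) j := by
  refine .seq (.setNat (.seq ?_))
  refine WP.for_const (fun k s' => ∀ j < k, s'.natArr 3 j = 0 ∧ s'.natArr 4 j = 0) (k₀ := 0)
    (N := cnt) 6 rfl rfl (by decide) rfl (by simpa using hcnt) (by omega) (by simp) ?_ ?_
  · rintro k s₁ - - - hk hI
    refine .seq (.putNat (.putNat ⟨by simp [NatExpr.cost], fun j hj => ?_⟩))
    simp only [NatExpr.eval, hk, writeArr_same, writeArr_ne _ _ _ (show (3 : ℕ) ≠ 4 by decide),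
      writeArr_ne _ _ _ (show (4 : ℕ) ≠ 3 by decide)]
    rcases Nat.lt_succ_iff_lt_or_eq.1 hj with hj | rfl
    · simpa [hj.ne] using hI j hj
    · simp
  rintro T₁ s₁ hF₁ hT₁ hI₁
  refine .seq (.setNat ?_)
  refine WP.for_const (fun k s' => ∀ j < cnt,
    s'.natArr 3 j = clusterCount k a (fun i => Y i = 0) j ∧
    s'.natArr 4 j = clusterCount k a (fun i => Y i ≠ 0) j) (k₀ := 0)
    (N := n) 17 rfl rfl (by decide) rfl ?_ (by omega)
    (fun j hj => by simpa [clusterCount_zero] using hI₁ j hj) ?_ ?_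
  · simpa [hF₁.natVar 0 rfl] using hn
  · rintro k s₂ hF₂ - hkn hk hI
    have eY : s₂.natArr 0 = Y := by
      rw [hF₂.natArr 0 rfl]
      exact (hF₁.natArr 0 rfl).trans hY
    have ea : s₂.natArr 2 = a := by
      rw [hF₂.natArr 2 rfl]
      exact (hF₁.natArr 2 rfl).trans ha
    refine .ite (fun hb => .putNat ⟨by simp [Test.cost, NatExpr.cost], fun j hj => ?_⟩)
      (fun hb => .putNat ⟨by simp [Test.cost, NatExpr.cost], fun j hj => ?_⟩)
    all_goals
      simp only [Test.Holds, NatExpr.eval, hk, eY] at hb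
      simp only [NatExpr.eval, hk, ea, writeArr_same, clusterCount_succ, hb,
        writeArr_ne _ _ _ (show (3 : ℕ) ≠ 4 by decide),
        writeArr_ne _ _ _ (show (4 : ℕ) ≠ 3 by decide), Function.update_apply]
      rw [← (hI j hj).1, ← (hI j hj).2]
      by_cases h : a k = j
      · simp [h, hb]
      · simp [h, Ne.symm h]
  · rintro T₂ s₂ hF₂ hT₂ hI₂
    refine ⟨?_, fun j hj => (hI₂ j hj).1, fun j hj => (hI₂ j hj).2⟩
    simp only [NatExpr.cost]
    omega

end Count

/-! ### The choice of the rate and the deletions -/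

section Rate

/-- The test whether the cluster with the number stored in the variable `1` is exempt. -/
def exemptTest : Test :=
  .and (.realLe (.mul (.ofNat (.add (.get 3 (.var 1)) (.get 4 (.var 1)))) (.var 2))
      (.ofNat (.var 0)))
    (.and
      (.realLt (.mul (.var 3) (.ofNat (.add (.get 3 (.var 1)) (.get 4 (.var 1)))))
        (.ofNat (.get 5 (.var 1))))
      (.realLt (.mul (.var 3) (.ofNat (.add (.get 3 (.var 1)) (.get 4 (.var 1)))))
        (.ofNat (.get 6 (.var 1)))))

theorem exemptTest_holds {d : ℕ → ℕ → ℝ} {s : State} {n k : ℕ} {T τ : ℝ} {n₀ n₁ N₀ N₁ : ℕ → ℕ}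
    (hn : s.natVar 0 = n) (hk : s.natVar 1 = k) (hT : s.realVar 2 = T) (hτ : s.realVar 3 = τ)
    (h3 : s.natArr 3 = n₀) (h4 : s.natArr 4 = n₁) (h5 : s.natArr 5 = N₀) (h6 : s.natArr 6 = N₁) :
    exemptTest.Holds d s ↔ Exempt n T τ (n₀ k + n₁ k) (N₀ k) (N₁ k) := by
  simp only [exemptTest, Test.Holds, RealExpr.eval, NatExpr.eval, hn, hk, hT, hτ, h3, h4, h5, h6,
    Exempt]

open Classical in
/-- The total size of the exempt clusters. -/
noncomputable def exemptWeight (n : ℕ) (T : ℝ) (cnt : ℕ) (n₀ n₁ N₀ N₁ : ℕ → ℕ) (τ : ℝ) : ℕ :=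
  ∑ j ∈ range cnt, if Exempt n T τ (n₀ j + n₁ j) (N₀ j) (N₁ j) then n₀ j + n₁ j else 0

/-- Double the rate until the exempt clusters fit twice the budget. -/
def chooseRate : Program :=
  .seq (.setReal 3 (.div (.ofNat (.const 1)) (.mul (.ofNat (.const 4)) (.ofNat (.var 0))))) <|
  .seq (.setNat 5 (.add (.add (.var 0) (.var 0)) (.const 1))) <|
  .loop (.realLt (.mul (.ofNat (.const 2)) (.ofNat (.var 0))) (.mul (.ofNat (.var 5)) (.var 2))) <|
  .seq (.setReal 3 (.add (.var 3) (.var 3))) <|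
  .seq (.setNat 5 (.const 0)) <|
  .seq (.setNat 1 (.const 0)) <|
  forLoop 1 3 <| .ite exemptTest
    (.setNat 5 (.add (.var 5) (.add (.get 3 (.var 1)) (.get 4 (.var 1)))))
    .skip

/-- Doubling replaces sorting the clusters by their rates: the final `τ` fits twice the budget,
while `τ / 2` did not fit unless `τ` is negligible. -/
theorem wp_chooseRate {d : ℕ → ℕ → ℝ} {n : ℕ} (hn1 : 1 ≤ n) {s : State} {cnt : ℕ} {T : ℝ}
    (hT : 1 ≤ T) {n₀ n₁ N₀ N₁ : ℕ → ℕ} (hn : s.natVar 0 = n) (hcnt : s.natVar 3 = cnt)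
    (hcn : cnt ≤ n) (hs : s.realVar 2 = T) (h3 : s.natArr 3 = n₀) (h4 : s.natArr 4 = n₁)
    (h5 : s.natArr 5 = N₀) (h6 : s.natArr 6 = N₁) (hN : ∀ j < cnt, N₀ j ≤ n) :
    WP d chooseRate s fun t s' => t ≤ (2 * Nat.log 2 n + 6) * (60 * n + 40) ∧
      0 ≤ s'.realVar 3 ∧
      (exemptWeight n T cnt n₀ n₁ N₀ N₁ (s'.realVar 3) : ℝ) * T ≤ 2 * n ∧
      (s'.realVar 3 * n < 1 ∨
        2 * (n : ℝ) < exemptWeight n T cnt n₀ n₁ N₀ N₁ (s'.realVar 3 / 2) * T) := by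
  classical
  set w := exemptWeight n T cnt n₀ n₁ N₀ N₁ with hw
  have hn0 : (0 : ℝ) < n := by exact_mod_cast hn1
  refine .seq (.setReal (.seq (.setNat ?_)))
  -- For `q = 0` the variable `5` holds the fictitious weight `2 n + 1`, which forces a first round.
  -- For `q ≥ 2` the weight at the preceding rate is known to have been too large.
  refine WP.loop (fun q t s' => s'.realVar 3 = 2 ^ q / (4 * n) ∧
    (q = 0 ∧ s'.natVar 5 = 2 * n + 1 ∨ 1 ≤ q ∧ s'.natVar 5 = w (s'.realVar 3) ∧
      (q = 1 ∨ 2 * (n : ℝ) < w (s'.realVar 3 / 2) * T)) ∧ t ≤ q * (60 * n + 40))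
    (2 * Nat.log 2 n + 4) ?_ ?_ ?_
  · refine ⟨by simp [RealExpr.eval, NatExpr.eval, hn], .inl ⟨rfl, ?_⟩, by simp⟩
    simp [NatExpr.eval, hn, two_mul]
  · rintro q t s₁ hF ⟨hτ, hW, ht⟩ hb
    have e0 : s₁.natVar 0 = n := by rw [hF.natVar 0 rfl]; simpa using hn
    have e3 : s₁.natVar 3 = cnt := by rw [hF.natVar 3 rfl]; simpa using hcnt
    have eT : s₁.realVar 2 = T := by rw [hF.realVar 2 rfl]; simpa using hs
    simp only [Test.Holds, RealExpr.eval, NatExpr.eval, e0, eT, Nat.cast_ofNat] at hb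
    refine ⟨?_, ?_⟩
    · rcases hW with ⟨rfl, -⟩ | ⟨-, hW, -⟩
      · omega
      rw [hW] at hb
      -- Another round requires a nonempty exempt cluster, so `τ < N₀ j ≤ n`. As `τ = 2 ^ q / (4
      -- n)`, this gives `2 ^ q < 4 n²` and bounds the rounds.
      have hpos : 0 < w (s₁.realVar 3) := by
        rw [Nat.pos_iff_ne_zero]
        intro h0
        rw [h0, Nat.cast_zero, zero_mul] at hb
        linarith
      obtain ⟨j, hj, hj0⟩ := exists_ne_zero_of_sum_ne_zero hpos.ne'
      have hE : Exempt n T (s₁.realVar 3) (n₀ j + n₁ j) (N₀ j) (N₁ j) := by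
        by_contra hne
        exact hj0 (if_neg hne)
      rw [if_pos hE] at hj0
      have h7 : (1 : ℝ) ≤ ((n₀ j + n₁ j : ℕ) : ℝ) := by
        exact_mod_cast Nat.one_le_iff_ne_zero.2 hj0
      have h8 : (N₀ j : ℝ) ≤ n := by exact_mod_cast hN j (mem_range.1 hj)
      have h9 : s₁.realVar 3 < n := by
        have : 0 ≤ s₁.realVar 3 := by rw [hτ]; positivity
        nlinarith [hE.2.1]
      rw [hτ, div_lt_iff₀ (by positivity)] at h9
      have h10 : 2 ^ q < n * (4 * n) := by exact_mod_cast h9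
      have h11 : n < 2 ^ (Nat.log 2 n + 1) := Nat.lt_pow_succ_log_self (by norm_num) n
      have h12 : n * (4 * n) < 2 ^ (2 * Nat.log 2 n + 4) := by
        have : 2 ^ (2 * Nat.log 2 n + 4) =
            4 * (2 ^ (Nat.log 2 n + 1) * 2 ^ (Nat.log 2 n + 1)) := by
          rw [← pow_add, show Nat.log 2 n + 1 + (Nat.log 2 n + 1) = 2 * Nat.log 2 n + 2 by ring,
            pow_add, pow_add]
          ring
        nlinarith
      exact (Nat.pow_lt_pow_iff_right (by norm_num)).1 (h10.trans h12)
    refine .seq (.setReal (.seq (.setNat (.seq (.setNat ?_)))))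
    refine WP.for_const (fun k s' =>
      s'.natVar 5 = exemptWeight n T k n₀ n₁ N₀ N₁ (2 * s₁.realVar 3))
      (k₀ := 0) (N := cnt) 46 rfl rfl (by decide) rfl (by simpa using e3) (by omega)
      (by simp [exemptWeight, NatExpr.eval]) ?_ ?_
    · rintro k s₂ hF₂ - hkn hk hI
      have g0 : s₂.natVar 0 = n := by rw [hF₂.natVar 0 rfl]; simpa using e0
      have g2 : s₂.realVar 2 = T := by rw [hF₂.realVar 2 rfl]; simpa using eT
      have g3 : s₂.realVar 3 = 2 * s₁.realVar 3 := by
        rw [hF₂.realVar 3 rfl]; simp [RealExpr.eval, two_mul]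
      have a3 : s₂.natArr 3 = n₀ := (hF₂.natArr 3 rfl).trans ((hF.natArr 3 rfl).trans h3)
      have a4 : s₂.natArr 4 = n₁ := (hF₂.natArr 4 rfl).trans ((hF.natArr 4 rfl).trans h4)
      have a5 : s₂.natArr 5 = N₀ := (hF₂.natArr 5 rfl).trans ((hF.natArr 5 rfl).trans h5)
      have a6 : s₂.natArr 6 = N₁ := (hF₂.natArr 6 rfl).trans ((hF.natArr 6 rfl).trans h6)
      refine .ite (fun hb => .setNat ⟨by decide, ?_⟩) (fun hb => .skip ⟨by decide, ?_⟩)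
      all_goals
        rw [exemptTest_holds g0 hk g2 g3 a3 a4 a5 a6] at hb
        simp only [exemptWeight] at hI
        simp [exemptWeight, sum_range_succ, hb, hI, NatExpr.eval, hk, a3, a4]
    · rintro T₂ s₂ hF₂ hT₂ hI₂
      have g3 : s₂.realVar 3 = 2 * s₁.realVar 3 := by
        rw [hF₂.realVar 3 rfl]; simp [RealExpr.eval, two_mul]
      refine ⟨?_, .inr ⟨by omega, ?_, ?_⟩, ?_⟩
      · rw [g3, hτ]
        ring
      · rw [hI₂, g3]
      · rcases hW with ⟨rfl, -⟩ | ⟨-, hW, -⟩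
        · exact .inl (by omega)
        · right
          rw [g3, mul_div_cancel_left₀ _ (by norm_num : (2 : ℝ) ≠ 0), ← hW]
          exact hb
      · have : (q + 1) * (60 * n + 40) = q * (60 * n + 40) + (60 * n + 40) := by ring
        simp only [Test.cost, RealExpr.cost, NatExpr.cost]
        omega
  · rintro q t s₁ hq hF ⟨hτ, hW, ht⟩ hb
    have e0 : s₁.natVar 0 = n := by rw [hF.natVar 0 rfl]; simpa using hn
    have eT : s₁.realVar 2 = T := by rw [hF.realVar 2 rfl]; simpa using hs
    simp only [Test.Holds, RealExpr.eval, NatExpr.eval, e0, eT, Nat.cast_ofNat, not_lt] at hb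
    refine ⟨?_, by rw [hτ]; positivity, ?_⟩
    · have : q * (60 * n + 40) ≤ (2 * Nat.log 2 n + 4) * (60 * n + 40) :=
        Nat.mul_le_mul_right _ hq
      have e : (2 * Nat.log 2 n + 6) * (60 * n + 40) =
        (2 * Nat.log 2 n + 4) * (60 * n + 40) + 2 * (60 * n + 40) := by ring
      simp only [Test.cost, RealExpr.cost, NatExpr.cost]
      omega
    · rcases hW with ⟨rfl, hW⟩ | ⟨-, hW, hq'⟩
      -- Exit at `q = 0` is impossible, as `(2 n + 1) T > 2 n`.
      · rw [hW] at hb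
        push_cast at hb
        nlinarith
      · refine ⟨by rw [← hW]; exact hb, ?_⟩
        rcases hq' with rfl | hq'
        -- After a single doubling, `τ n = 1 / 2`.
        · left
          rw [hτ]
          field_simp
          norm_num
        · exact .inr hq'

/-- Mark the clusters in whose neighbourhood the points labelled `0`, or those labelled `1`, are
to be deleted. -/
def markClusters : Program :=
  .seq (.setNat 1 (.const 0)) <|
  forLoop 1 3 <|
    .seq (.putNat 7 (.var 1) (.const 0)) <|
    .seq (.putNat 8 (.var 1) (.const 0)) <|
    .ite exemptTest .skip <|
    .ite (.natLt (.get 6 (.var 1)) (.get 5 (.var 1)))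
      (.putNat 8 (.var 1) (.const 1))
      (.putNat 7 (.var 1) (.const 1))

theorem wp_markClusters {d : ℕ → ℕ → ℝ} {n : ℕ} {s : State} {cnt : ℕ} {T τ : ℝ}
    {n₀ n₁ N₀ N₁ : ℕ → ℕ} (hn : s.natVar 0 = n) (hcnt : s.natVar 3 = cnt) (hcn : cnt ≤ n)
    (hT : s.realVar 2 = T) (hτ : s.realVar 3 = τ) (h3 : s.natArr 3 = n₀) (h4 : s.natArr 4 = n₁)
    (h5 : s.natArr 5 = N₀) (h6 : s.natArr 6 = N₁) :
    WP d markClusters s fun t s' => t ≤ 80 * n + 10 ∧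
      (∀ j < cnt, s'.natArr 7 j ≠ 0 ↔
        ¬ Exempt n T τ (n₀ j + n₁ j) (N₀ j) (N₁ j) ∧ N₀ j ≤ N₁ j) ∧
      ∀ j < cnt, s'.natArr 8 j ≠ 0 ↔
        ¬ Exempt n T τ (n₀ j + n₁ j) (N₀ j) (N₁ j) ∧ N₁ j < N₀ j := by
  refine .seq (.setNat ?_)
  refine WP.for_const (fun k s' => ∀ j < k,
    (s'.natArr 7 j ≠ 0 ↔ ¬ Exempt n T τ (n₀ j + n₁ j) (N₀ j) (N₁ j) ∧ N₀ j ≤ N₁ j) ∧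
    (s'.natArr 8 j ≠ 0 ↔ ¬ Exempt n T τ (n₀ j + n₁ j) (N₀ j) (N₁ j) ∧ N₁ j < N₀ j))
    (k₀ := 0) (N := cnt) 60 rfl rfl (by decide) rfl (by simpa using hcnt) (by omega)
    (by simp) ?_ ?_
  · rintro k s₁ hF - hkn hk hI
    have g0 : s₁.natVar 0 = n := by rw [hF.natVar 0 rfl]; simpa using hn
    have g2 : s₁.realVar 2 = T := by rw [hF.realVar 2 rfl]; simpa using hT
    have g3 : s₁.realVar 3 = τ := by rw [hF.realVar 3 rfl]; simpa using hτ
    have a3 : s₁.natArr 3 = n₀ := (hF.natArr 3 rfl).trans h3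
    have a4 : s₁.natArr 4 = n₁ := (hF.natArr 4 rfl).trans h4
    have a5 : s₁.natArr 5 = N₀ := (hF.natArr 5 rfl).trans h5
    have a6 : s₁.natArr 6 = N₁ := (hF.natArr 6 rfl).trans h6
    have step : ∀ (m₇ m₈ : ℕ → ℕ) (c₇ c₈ : ℕ), m₇ = Function.update (s₁.natArr 7) k c₇ →
        m₈ = Function.update (s₁.natArr 8) k c₈ →
        (c₇ ≠ 0 ↔ ¬ Exempt n T τ (n₀ k + n₁ k) (N₀ k) (N₁ k) ∧ N₀ k ≤ N₁ k) →
        (c₈ ≠ 0 ↔ ¬ Exempt n T τ (n₀ k + n₁ k) (N₀ k) (N₁ k) ∧ N₁ k < N₀ k) →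
        ∀ j < k + 1,
        (m₇ j ≠ 0 ↔ ¬ Exempt n T τ (n₀ j + n₁ j) (N₀ j) (N₁ j) ∧ N₀ j ≤ N₁ j) ∧
        (m₈ j ≠ 0 ↔ ¬ Exempt n T τ (n₀ j + n₁ j) (N₀ j) (N₁ j) ∧ N₁ j < N₀ j) := by
      rintro _ _ c₇ c₈ rfl rfl h7 h8 j hj
      rcases Nat.lt_succ_iff_lt_or_eq.1 hj with hj | rfl
      · rw [Function.update_of_ne hj.ne, Function.update_of_ne hj.ne]
        exact hI j hj
      · rw [Function.update_self, Function.update_self]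
        exact ⟨h7, h8⟩
    refine .seq (.putNat (.seq (.putNat (.ite (fun hb => .skip ⟨by decide, ?_⟩) (fun hb =>
      .ite (fun hb' => .putNat ⟨by decide, ?_⟩) (fun hb' => .putNat ⟨by decide, ?_⟩))))))
    all_goals
      rw [exemptTest_holds (n := n) (k := k) (T := T) (τ := τ) (n₀ := n₀) (n₁ := n₁) (N₀ := N₀)
        (N₁ := N₁) (by simpa using g0) (by simpa using hk) (by simpa using g2) (by simpa using g3)
        (by simpa [writeArr_ne] using a3) (by simpa [writeArr_ne] using a4)
        (by simpa [writeArr_ne] using a5) (by simpa [writeArr_ne] using a6)] at hb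
    · refine step _ _ 0 0 ?_ ?_ (by simp [hb]) (by simp [hb])
      · simp [NatExpr.eval, writeArr_same, writeArr_ne, hk]
      · simp [NatExpr.eval, writeArr_same, writeArr_ne, hk]
    all_goals
      simp only [Test.Holds, NatExpr.eval, hk,
        writeArr_ne _ _ _ (show (5 : ℕ) ≠ 7 by decide),
        writeArr_ne _ _ _ (show (5 : ℕ) ≠ 8 by decide),
        writeArr_ne _ _ _ (show (6 : ℕ) ≠ 7 by decide),
        writeArr_ne _ _ _ (show (6 : ℕ) ≠ 8 by decide), a5, a6] at hb'
    · refine step _ _ 0 1 ?_ ?_ (by simp [hb, hb']) (by simp [hb, hb'])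
      · simp [NatExpr.eval, writeArr_same, writeArr_ne, hk]
      · simp [NatExpr.eval, writeArr_same, writeArr_ne, hk]
    · refine step _ _ 1 0 ?_ ?_ (by simpa [hb] using hb') (by simpa [hb] using hb')
      · simp [NatExpr.eval, writeArr_same, writeArr_ne, hk]
      · simp [NatExpr.eval, writeArr_same, writeArr_ne, hk]
  · rintro t s₁ hF ht hI
    refine ⟨?_, fun j hj => (hI j hj).1, fun j hj => (hI j hj).2⟩
    simp only [NatExpr.cost]
    omega

/-- Delete the points labelled `0` in the clusters with a nonzero entry in the array `9`, and
those labelled `1` in the clusters with a nonzero entry in the array `10`. -/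
def deletePoints : Program :=
  .seq (.setNat 1 (.const 0)) <|
  forLoop 1 0 <| .ite (.natEq (.get 0 (.var 1)) (.const 0))
    (.ite (.natLt (.const 0) (.get 9 (.get 2 (.var 1)))) (.putNat 11 (.var 1) (.const 1)) .skip)
    (.ite (.natLt (.const 0) (.get 10 (.get 2 (.var 1)))) (.putNat 11 (.var 1) (.const 1)) .skip)

theorem wp_deletePoints {d : ℕ → ℕ → ℝ} {n : ℕ} {s : State} {Y a K₀ K₁ : ℕ → ℕ}
    (hn : s.natVar 0 = n) (hY : s.natArr 0 = Y) (ha : s.natArr 2 = a) (h9 : s.natArr 9 = K₀)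
    (h10 : s.natArr 10 = K₁) :
    WP d deletePoints s fun t s' => t ≤ 40 * n + 10 ∧ ∀ i < n, s'.natArr 11 i ≠ 0 ↔
      s.natArr 11 i ≠ 0 ∨ (Y i = 0 ∧ K₀ (a i) ≠ 0 ∨ Y i ≠ 0 ∧ K₁ (a i) ≠ 0) := by
  refine .seq (.setNat ?_)
  refine WP.for_const (fun k s' => (∀ i < k, s'.natArr 11 i ≠ 0 ↔
      s.natArr 11 i ≠ 0 ∨ (Y i = 0 ∧ K₀ (a i) ≠ 0 ∨ Y i ≠ 0 ∧ K₁ (a i) ≠ 0)) ∧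
      ∀ i, k ≤ i → s'.natArr 11 i = s.natArr 11 i)
    (k₀ := 0) (N := n) 30 rfl rfl (by decide) rfl (by simpa using hn) (by omega)
    (by simp) ?_ ?_
  · rintro k s₁ hF - hkn hk ⟨hI, hI'⟩
    have a0 : s₁.natArr 0 = Y := (hF.natArr 0 rfl).trans hY
    have a2 : s₁.natArr 2 = a := (hF.natArr 2 rfl).trans ha
    have a9 : s₁.natArr 9 = K₀ := (hF.natArr 9 rfl).trans h9
    have a10 : s₁.natArr 10 = K₁ := (hF.natArr 10 rfl).trans h10
    have step : ∀ (m : ℕ → ℕ) (c : ℕ), m = Function.update (s₁.natArr 11) k c →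
        (c ≠ 0 ↔ s.natArr 11 k ≠ 0 ∨ (Y k = 0 ∧ K₀ (a k) ≠ 0 ∨ Y k ≠ 0 ∧ K₁ (a k) ≠ 0)) →
        (∀ i < k + 1, m i ≠ 0 ↔
          s.natArr 11 i ≠ 0 ∨ (Y i = 0 ∧ K₀ (a i) ≠ 0 ∨ Y i ≠ 0 ∧ K₁ (a i) ≠ 0)) ∧
        ∀ i, k + 1 ≤ i → m i = s.natArr 11 i := by
      rintro _ c rfl hc
      refine ⟨fun i hi => ?_, fun i hi => ?_⟩
      · rcases Nat.lt_succ_iff_lt_or_eq.1 hi with hi | rfl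
        · rw [Function.update_of_ne hi.ne]
          exact hI i hi
        · rw [Function.update_self]
          exact hc
      · rw [Function.update_of_ne (by omega)]
        exact hI' i (by omega)
    refine .ite (fun hb => .ite (fun hb' => .putNat ⟨by decide, ?_⟩) fun hb' =>
      .skip ⟨by decide, ?_⟩) (fun hb => .ite (fun hb' => .putNat ⟨by decide, ?_⟩) fun hb' =>
      .skip ⟨by decide, ?_⟩)
    all_goals
      simp only [Test.Holds, NatExpr.eval, hk, a0, a2, a9, a10, Nat.pos_iff_ne_zero, not_not]
        at hb hb'
    · exact step _ 1 (by simp [NatExpr.eval, writeArr_same, hk]) (by simp [hb, hb'])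
    · exact step _ (s.natArr 11 k) (by rw [← hI' k le_rfl]; simp) (by simp [hb, hb'])
    · exact step _ 1 (by simp [NatExpr.eval, writeArr_same, hk]) (by simp [hb, hb'])
    · exact step _ (s.natArr 11 k) (by rw [← hI' k le_rfl]; simp) (by simp [hb, hb'])
  · rintro t s₁ hF ht ⟨hI, -⟩
    refine ⟨?_, hI⟩
    simp only [NatExpr.cost]
    omega

end Rate

/-! ### Interpolation -/

section Interpolation

variable {Ω : Type u} [MetricSpace Ω]

theorem IsTruncDist.congr {X : ℕ → Ω} {M : ℝ} {V V' : ℕ → Prop} {i : ℕ} {a : ℝ}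
    (h : IsTruncDist X M V i a) (hV : ∀ u, V' u ↔ V u) : IsTruncDist X M V' i a := by
  rwa [show V' = V from funext fun u => propext (hV u)]

theorem IsTruncDist.insert {X : ℕ → Ω} {M : ℝ} {V V' : ℕ → Prop} {i m : ℕ} {a : ℝ}
    (h : IsTruncDist X M V i a) (hV : ∀ u, V' u ↔ V u ∨ u = m) :
    IsTruncDist X M V' i (min a (dist (X i) (X m))) := by
  refine ⟨(min_le_left _ _).trans h.le_bound, fun u hu => ?_, ?_⟩
  · rcases (hV u).1 hu with hu | rfl
    · exact (min_le_left _ _).trans (h.le_dist u hu)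
    · exact min_le_right _ _
  · rcases min_choice a (dist (X i) (X m)) with e | e
    · rw [e]
      exact h.attained.imp_right fun ⟨u, hu, ha⟩ => ⟨u, (hV u).2 (.inl hu), ha⟩
    · exact .inr ⟨m, (hV m).2 (.inr rfl), e⟩

/-- Interpolate between the points that are not deleted. -/
def interpolate : Program :=
  .seq (.setNat 1 (.const 0)) <|
  forLoop 1 0 <|
    .seq (.setReal 4 (.div (.ofNat (.const 1)) (.var 0))) <|
    .seq (.setReal 5 (.div (.ofNat (.const 1)) (.var 0))) <|
    .seq (.setNat 2 (.const 0)) <|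
    .seq (forLoop 2 0 <|
      .ite (.natEq (.get 11 (.var 2)) (.const 0))
        (.ite (.natEq (.get 0 (.var 2)) (.const 0))
          (.ite (.realLt (.dist (.var 1) (.var 2)) (.var 4))
            (.setReal 4 (.dist (.var 1) (.var 2))) .skip)
          (.ite (.realLt (.dist (.var 1) (.var 2)) (.var 5))
            (.setReal 5 (.dist (.var 1) (.var 2))) .skip))
        .skip) <|
    .putReal 0 (.var 1) (.div (.var 4) (.add (.var 4) (.var 5)))

theorem wp_interpolate {d : ℕ → ℕ → ℝ} {X : ℕ → Ω} {n : ℕ}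
    (hd : ∀ i < n, ∀ j < n, d i j = dist (X i) (X j)) {s : State} {Y del : ℕ → ℕ} {L : ℝ}
    (hn : s.natVar 0 = n) (hL : s.realVar 0 = L) (hY : s.natArr 0 = Y)
    (hdel : s.natArr 11 = del) :
    WP d interpolate s fun t s' => t ≤ n * (40 * n + 50) + 10 ∧ ∀ i < n, ∃ α β : ℝ,
      IsTruncDist X (1 / L) (fun u => u < n ∧ del u = 0 ∧ Y u = 0) i α ∧
      IsTruncDist X (1 / L) (fun u => u < n ∧ del u = 0 ∧ Y u ≠ 0) i β ∧
      s'.realArr 0 i = α / (α + β) := by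
  refine .seq (.setNat ?_)
  refine WP.for_const (fun k s' => ∀ i < k, ∃ α β : ℝ,
      IsTruncDist X (1 / L) (fun u => u < n ∧ del u = 0 ∧ Y u = 0) i α ∧
      IsTruncDist X (1 / L) (fun u => u < n ∧ del u = 0 ∧ Y u ≠ 0) i β ∧
      s'.realArr 0 i = α / (α + β)) (k₀ := 0) (N := n) (40 * n + 40)
    rfl rfl (by decide) rfl (by simpa using hn) (by omega) (by simp) ?_ ?_
  · rintro k s₁ hF - hkn hk hI
    have g0 : s₁.natVar 0 = n := by rw [hF.natVar 0 rfl]; simpa using hn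
    have gL : s₁.realVar 0 = L := by rw [hF.realVar 0 rfl]; simpa using hL
    have a0 : s₁.natArr 0 = Y := (hF.natArr 0 rfl).trans hY
    have a11 : s₁.natArr 11 = del := (hF.natArr 11 rfl).trans hdel
    refine .seq (.setReal (.seq (.setReal (.seq (.setNat (.seq ?_))))))
    refine WP.for_const (fun m s' =>
      IsTruncDist X (1 / L) (fun u => u < m ∧ del u = 0 ∧ Y u = 0) k (s'.realVar 4) ∧
      IsTruncDist X (1 / L) (fun u => u < m ∧ del u = 0 ∧ Y u ≠ 0) k (s'.realVar 5))
      (k₀ := 0) (N := n) 25 rfl rfl (by decide) rfl (by simpa using g0) (by omega) ?_ ?_ ?_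
    · constructor <;> exact ⟨by simp [RealExpr.eval, NatExpr.eval, gL], by simp,
        .inl (by simp [RealExpr.eval, NatExpr.eval, gL])⟩
    · rintro m s₂ hF₂ - hmn hm ⟨h4, h5⟩
      have e0 : s₂.natArr 0 = Y := (hF₂.natArr 0 rfl).trans a0
      have e11 : s₂.natArr 11 = del := (hF₂.natArr 11 rfl).trans a11
      have e1 : s₂.natVar 1 = k := by rw [hF₂.natVar 1 rfl]; simpa using hk
      have skip : ∀ {q : ℕ → Prop} {c : ℝ}, ¬ q m →
          IsTruncDist X (1 / L) (fun u => u < m ∧ q u) k c →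
          IsTruncDist X (1 / L) (fun u => u < m + 1 ∧ q u) k c := by
        intro q c hq h
        refine h.congr fun u => ⟨fun ⟨hu, hqu⟩ => ⟨?_, hqu⟩, fun ⟨hu, hqu⟩ => ⟨by omega, hqu⟩⟩
        have : u ≠ m := by rintro rfl; exact hq hqu
        omega
      have take : ∀ {q : ℕ → Prop} {c c' : ℝ}, q m → c' = min c (dist (X k) (X m)) →
          IsTruncDist X (1 / L) (fun u => u < m ∧ q u) k c →
          IsTruncDist X (1 / L) (fun u => u < m + 1 ∧ q u) k c' := by
        rintro q c _ hq rfl h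
        refine h.insert fun u => ⟨fun ⟨hu, hqu⟩ => ?_, ?_⟩
        · rcases Nat.lt_succ_iff_lt_or_eq.1 hu with hu | hu
          · exact .inl ⟨hu, hqu⟩
          · exact .inr hu
        · rintro (⟨hu, hqu⟩ | rfl)
          · exact ⟨by omega, hqu⟩
          · exact ⟨Nat.lt_succ_self _, hq⟩
      refine .ite (fun hb => .ite
        (fun hb₁ => .ite (fun hb₂ => .setReal ⟨by decide, ?_⟩) fun hb₂ => .skip ⟨by decide, ?_⟩)
        (fun hb₁ => .ite (fun hb₂ => .setReal ⟨by decide, ?_⟩) fun hb₂ => .skip ⟨by decide, ?_⟩))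
        (fun hb => .skip ⟨by decide, ?_⟩)
      rotate_left 4
      · simp only [Test.Holds, NatExpr.eval, hm, e11] at hb
        exact ⟨skip (fun h => hb h.1) h4, skip (fun h => hb h.1) h5⟩
      all_goals
        simp only [Test.Holds, NatExpr.eval, RealExpr.eval, hm, e0, e11, e1,
          hd _ hkn _ hmn] at hb hb₁ hb₂
      · refine ⟨take ⟨hb, hb₁⟩ ?_ h4, skip (fun h => h.2 hb₁) ?_⟩
        · simp [RealExpr.eval, NatExpr.eval, hm, e1, hd _ hkn _ hmn, min_eq_right hb₂.le]
        · simpa using h5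
      · exact ⟨take ⟨hb, hb₁⟩ (min_eq_left (not_lt.1 hb₂)).symm h4, skip (fun h => h.2 hb₁) h5⟩
      · refine ⟨skip (fun h => hb₁ h.2) ?_, take ⟨hb, hb₁⟩ ?_ h5⟩
        · simpa using h4
        · simp [RealExpr.eval, NatExpr.eval, hm, e1, hd _ hkn _ hmn, min_eq_right hb₂.le]
      · exact ⟨skip (fun h => hb₁ h.2) h4, take ⟨hb, hb₁⟩ (min_eq_left (not_lt.1 hb₂)).symm h5⟩
    · rintro t s₂ hF₂ ht ⟨h4, h5⟩
      have e1 : s₂.natVar 1 = k := by rw [hF₂.natVar 1 rfl]; simpa using hk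
      have er : s₂.realArr 0 = s₁.realArr 0 := hF₂.realArr 0 rfl
      refine .putReal ⟨?_, fun i hi => ?_⟩
      · simp only [RealExpr.cost, NatExpr.cost]
        omega
      · simp only [NatExpr.eval, RealExpr.eval, e1, writeArr_same, er]
        rcases Nat.lt_succ_iff_lt_or_eq.1 hi with hi | rfl
        · rw [Function.update_of_ne hi.ne]
          exact hI i hi
        · exact ⟨_, _, h4, h5, by rw [Function.update_self]⟩
  · rintro t s₁ hF ht hI
    refine ⟨?_, hI⟩
    have : (n - 0) * (40 * n + 40 + 8) ≤ n * (40 * n + 50) :=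
      Nat.mul_le_mul (by omega) (by omega)
    simp only [NatExpr.cost]
    omega

end Interpolation

/-! ### A single scale -/

section SingleScale

variable {Ω : Type u} [MetricSpace Ω]

/-- The data shared by the parts of the computation at a single scale. -/
structure ScaleContext (n cnt old : ℕ) (L T ρ : ℝ) (Y p a : ℕ → ℕ) (s : State) : Prop where
  n_eq : s.natVar 0 = n
  cnt_eq : s.natVar 3 = cnt
  old_eq : s.natVar 4 = old
  L_eq : s.realVar 0 = L
  ρ_eq : s.realVar 1 = ρ
  T_eq : s.realVar 2 = T
  Y_eq : s.natArr 0 = Y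
  p_eq : s.natArr 1 = p
  a_eq : s.natArr 2 = a

/-- The program does not write to the data shared by the parts of the computation. -/
def Program.keepsContext (p : Program) : Bool :=
  !(p.writesNatVar 0 || p.writesNatVar 3 || p.writesNatVar 4 || p.writesRealVar 0 ||
    p.writesRealVar 1 || p.writesRealVar 2 || p.writesNatArr 0 || p.writesNatArr 1 ||
    p.writesNatArr 2)

theorem ScaleContext.frame {n cnt old : ℕ} {L T ρ : ℝ} {Y p a : ℕ → ℕ} {s s' : State}
    {P : Program} (h : ScaleContext n cnt old L T ρ Y p a s) (hF : Frame P s s')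
    (hP : P.keepsContext = true) : ScaleContext n cnt old L T ρ Y p a s' := by
  simp only [Program.keepsContext, Bool.not_eq_true', Bool.or_eq_false_iff] at hP
  obtain ⟨⟨⟨⟨⟨⟨⟨⟨h0, h3⟩, h4⟩, hL⟩, hρ⟩, hT⟩, hY⟩, hp⟩, ha⟩ := hP
  exact ⟨(hF.natVar 0 h0).trans h.n_eq, (hF.natVar 3 h3).trans h.cnt_eq,
    (hF.natVar 4 h4).trans h.old_eq, (hF.realVar 0 hL).trans h.L_eq,
    (hF.realVar 1 hρ).trans h.ρ_eq, (hF.realVar 2 hT).trans h.T_eq,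
    (hF.natArr 0 hY).trans h.Y_eq, (hF.natArr 1 hp).trans h.p_eq, (hF.natArr 2 ha).trans h.a_eq⟩

/-- The computation at the scale stored in the real variable `2`. -/
def scaleStep : Program :=
  .seq (.setReal 1 (.div (.ofNat (.const 1))
    (.mul (.mul (.ofNat (.const 10)) (.var 2)) (.var 0)))) <|
  .seq refineNet <|
  .seq countLabels <|
  .seq (neighbourSum 3 5) <|
  .seq (neighbourSum 4 6) <|
  .seq chooseRate <|
  .seq markClusters <|
  .seq (neighbourSum 7 9) <|
  .seq (neighbourSum 8 10) deletePoints

theorem ScaleData.weight_eq {n : ℕ} {X : ℕ → Ω} {Y : ℕ → ℕ} {ρ T : ℝ} (S : ScaleData n X Y ρ T)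
    (τ : ℝ) : S.weight τ = exemptWeight n T S.cnt S.n₀ S.n₁ S.N₀ S.N₁ τ := by
  rw [weight, exemptSet, sum_filter, exemptWeight]

/-- With this, `neighbourSum` applied to marks decides whether some neighbouring cluster is marked.
-/
theorem sum_ne_zero_iff_exists {S : Finset ℕ} {f : ℕ → ℕ} :
    ∑ j ∈ S, f j ≠ 0 ↔ ∃ j ∈ S, f j ≠ 0 := by
  rw [Ne, sum_eq_zero_iff]
  push Not
  rfl

/-- The factor `4` in `hR` makes the old centres more than `3ρ` apart, as the neighbour sums need.
The guarantee on steep sets holds for every `U` avoiding `del`, so it survives deletions at other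
scales. -/
theorem wp_scaleStep {d : ℕ → ℕ → ℝ} {X : ℕ → Ω} {n : ℕ} (hn1 : 1 ≤ n)
    (hd : ∀ i < n, ∀ j < n, d i j = dist (X i) (X j)) {s : State} {L T R : ℝ} {cnt : ℕ}
    {Y : ℕ → ℕ} (hn : s.natVar 0 = n) (hcnt : s.natVar 3 = cnt) (hsL : s.realVar 0 = L)
    (hL : 0 < L) (hsT : s.realVar 2 = T) (hT : 1 ≤ T) (hY : s.natArr 0 = Y)
    (hR : 4 * (1 / (10 * T * L)) ≤ R)
    (hnet : IsNet n X (1 / L) R cnt (s.natArr 1) (s.natArr 2) (s.realArr 1)) :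
    WP d scaleStep s fun t s' => cnt ≤ s'.natVar 3 ∧
      t ≤ 300 * n * (s'.natVar 3 - cnt) + (2 * Nat.log 2 n + 10) * (100 * n + 40) ∧
      IsNet n X (1 / L) (1 / (10 * T * L)) (s'.natVar 3) (s'.natArr 1) (s'.natArr 2)
        (s'.realArr 1) ∧
      ∃ del : Finset ℕ, (∀ i < n, s'.natArr 11 i ≠ 0 ↔ s.natArr 11 i ≠ 0 ∨ i ∈ del) ∧
        (∀ U : Finset ℕ, (∀ i ∈ U, i < n ∧ i ∉ del) →
          (#(steepSet n X Y U (1 / (10 * T * L))) : ℝ) * T ≤ 2 * n) ∧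
        ∀ D : ℕ, DoublingWith Ω D → ∀ U : Finset ℕ,
          (#(steepSet n X Y U (1 / (T * L))) : ℝ) * T ≤ n →
          #del ≤ 3 * D ^ 3 * #(range n \ U) := by
  classical
  set ρ := 1 / (10 * T * L) with hρ
  have hρ0 : 0 < ρ := by positivity
  have hρL : ρ < 1 / L := by
    refine one_div_lt_one_div_of_lt hL ?_
    nlinarith
  have h10 : 10 * ρ = 1 / (T * L) := by
    rw [hρ]
    field_simp
  refine .seq (.setReal (.seq ?_))
  refine WP.mono (wp_refineNet hd (ρ := ρ) (by simpa using hn) (by simpa using hcnt)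
    (by simp [RealExpr.eval, NatExpr.eval, hsT, hsL, hρ]) hρ0.le (by linarith) hρL rfl
    hnet) ?_
  rintro t₂ s₂ F₂ ⟨hold, hcnt₂, ht₂, hnet₂, hclu, hp₂⟩
  obtain ⟨cnt', hcnt'⟩ : ∃ c, s₂.natVar 3 = c := ⟨_, rfl⟩
  obtain ⟨p, hp⟩ : ∃ p, s₂.natArr 1 = p := ⟨_, rfl⟩
  obtain ⟨a, ha⟩ : ∃ a, s₂.natArr 2 = a := ⟨_, rfl⟩
  rw [hcnt', hp, ha] at hnet₂ hclu
  rw [hcnt'] at hcnt₂ ht₂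
  have hcn := hnet₂.cnt_le hρ0.le
  have hsep : ∀ j < cnt, ∀ l < cnt, j ≠ l → 3 * ρ < dist (X (p j)) (X (p l)) := by
    intro j hj l hl hjl
    rw [← hp, hp₂ j hj, hp₂ l hl]
    have := hnet.separated j hj l hl hjl
    exact lt_of_le_of_lt (by linarith) this
  have c₂ : ScaleContext n cnt' cnt L T ρ Y p a s₂ := by
    refine ⟨?_, hcnt', hold, ?_, ?_, ?_, ?_, hp, ha⟩
    · rw [F₂.natVar 0 rfl]; simpa using hn
    · rw [F₂.realVar 0 rfl]; simpa using hsL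
    · rw [F₂.realVar 1 rfl]; simp [RealExpr.eval, NatExpr.eval, hsT, hsL, hρ]
    · rw [F₂.realVar 2 rfl]; simpa using hsT
    · rw [F₂.natArr 0 rfl]; simpa using hY
  refine .seq ((wp_countLabels c₂.n_eq c₂.cnt_eq hcn c₂.Y_eq c₂.a_eq).mono ?_)
  rintro t₃ s₃ F₃ ⟨ht₃, hn₀, hn₁⟩
  have c₃ := c₂.frame F₃ rfl
  refine .seq ((wp_neighbourSum hd (b := 3) (c := 5) (by decide) (by decide) c₃.cnt_eq c₃.old_eq
    hcnt₂ hcn c₃.ρ_eq hρ0.le c₃.p_eq hnet₂.centre_lt hsep).mono ?_)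
  rintro t₄ s₄ F₄ ⟨ht₄, hN₀⟩
  have c₄ := c₃.frame F₄ rfl
  refine .seq ((wp_neighbourSum hd (b := 4) (c := 6) (by decide) (by decide) c₄.cnt_eq c₄.old_eq
    hcnt₂ hcn c₄.ρ_eq hρ0.le c₄.p_eq hnet₂.centre_lt hsep).mono ?_)
  rintro t₅ s₅ F₅ ⟨ht₅, hN₁⟩
  have c₅ := c₄.frame F₅ rfl
  obtain ⟨n₀, e3⟩ : ∃ f, s₃.natArr 3 = f := ⟨_, rfl⟩
  obtain ⟨n₁, e4⟩ : ∃ f, s₃.natArr 4 = f := ⟨_, rfl⟩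
  obtain ⟨N₀, e5⟩ : ∃ f, s₄.natArr 5 = f := ⟨_, rfl⟩
  obtain ⟨N₁, e6⟩ : ∃ f, s₅.natArr 6 = f := ⟨_, rfl⟩
  rw [e3] at hn₀
  rw [e4] at hn₁
  rw [e3, e5] at hN₀
  rw [F₄.natArr 4 rfl, e4, e6] at hN₁
  have hNn : ∀ j < cnt', N₀ j ≤ n := by
    intro j hj
    rw [hN₀ j hj, sum_congr rfl fun l hl => hn₀ l (mem_neighbours.1 hl).1, sum_clusterCount]
    exact (card_filter_le _ _).trans (card_range n).le
  have f3 : s₅.natArr 3 = n₀ := by rw [F₅.natArr 3 rfl, F₄.natArr 3 rfl, e3]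
  have f4 : s₅.natArr 4 = n₁ := by rw [F₅.natArr 4 rfl, F₄.natArr 4 rfl, e4]
  have f5 : s₅.natArr 5 = N₀ := by rw [F₅.natArr 5 rfl, e5]
  refine .seq ((wp_chooseRate hn1 hT c₅.n_eq c₅.cnt_eq hcn c₅.T_eq f3 f4 f5 e6 hNn).mono ?_)
  rintro t₆ s₆ F₆ ⟨ht₆, hτ0, hw, hrate⟩
  have c₆ := c₅.frame F₆ rfl
  obtain ⟨τ, hτ⟩ : ∃ r, s₆.realVar 3 = r := ⟨_, rfl⟩
  rw [hτ] at hτ0 hw hrate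
  refine .seq ((wp_markClusters c₆.n_eq c₆.cnt_eq hcn c₆.T_eq hτ ((F₆.natArr 3 rfl).trans f3)
    ((F₆.natArr 4 rfl).trans f4) ((F₆.natArr 5 rfl).trans f5)
    ((F₆.natArr 6 rfl).trans e6)).mono ?_)
  rintro t₇ s₇ F₇ ⟨ht₇, hm₀, hm₁⟩
  have c₇ := c₆.frame F₇ rfl
  refine .seq ((wp_neighbourSum hd (b := 7) (c := 9) (by decide) (by decide) c₇.cnt_eq c₇.old_eq
    hcnt₂ hcn c₇.ρ_eq hρ0.le c₇.p_eq hnet₂.centre_lt hsep).mono ?_)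
  rintro t₈ s₈ F₈ ⟨ht₈, hK₀⟩
  have c₈ := c₇.frame F₈ rfl
  refine .seq ((wp_neighbourSum hd (b := 8) (c := 10) (by decide) (by decide) c₈.cnt_eq c₈.old_eq
    hcnt₂ hcn c₈.ρ_eq hρ0.le c₈.p_eq hnet₂.centre_lt hsep).mono ?_)
  rintro t₉ s₉ F₉ ⟨ht₉, hK₁⟩
  have c₉ := c₈.frame F₉ rfl
  refine (wp_deletePoints c₉.n_eq c₉.Y_eq c₉.a_eq rfl rfl).mono ?_
  rintro t s' F ⟨ht, hdel⟩
  have c := c₉.frame F rfl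
  let S : ScaleData n X Y ρ T :=
    { cnt := cnt', p := p, a := a, n₀ := n₀, n₁ := n₁, N₀ := N₀, N₁ := N₁, τ := τ
      del := {i ∈ range n |
        (Y i = 0 ∧ ∃ j ∈ neighbours X ρ cnt' p (a i),
          ¬ Exempt n T τ (n₀ j + n₁ j) (N₀ j) (N₁ j) ∧ N₀ j ≤ N₁ j) ∨
        (Y i ≠ 0 ∧ ∃ j ∈ neighbours X ρ cnt' p (a i),
          ¬ Exempt n T τ (n₀ j + n₁ j) (N₀ j) (N₁ j) ∧ N₁ j < N₀ j)}
      clustering := hclu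
      n₀_eq := hn₀
      n₁_eq := hn₁
      N₀_eq := hN₀
      N₁_eq := hN₁
      mem_del := fun i => by rw [mem_filter, mem_range] }
  refine ⟨by rw [c.cnt_eq]; exact hcnt₂, ?_, ?_, S.del, ?_, ?_, ?_⟩
  · rw [c.cnt_eq]
    have e1 : 300 * n * (cnt' - cnt) = 300 * (n * (cnt' - cnt)) := by ring
    have e2 : (2 * Nat.log 2 n + 10) * (100 * n + 40) =
      (2 * Nat.log 2 n + 6) * (60 * n + 40) + (2 * Nat.log 2 n + 6) * (40 * n) +
        4 * (100 * n + 40) := by ring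
    have e3 : 6 * (40 * n) ≤ (2 * Nat.log 2 n + 6) * (40 * n) :=
      Nat.mul_le_mul_right _ (by omega)
    have e4 : 60 * n * (cnt' - cnt) = 60 * (n * (cnt' - cnt)) := by ring
    have e5 : 50 * n * (cnt' - cnt) = 50 * (n * (cnt' - cnt)) := by ring
    rw [e4] at ht₄ ht₅ ht₈ ht₉
    rw [e5] at ht₂
    rw [e1, e2]
    simp only [RealExpr.cost, NatExpr.cost]
    omega
  · have e : s'.realArr 1 = s₂.realArr 1 := by
      rw [F.realArr 1 rfl, F₉.realArr 1 rfl, F₈.realArr 1 rfl, F₇.realArr 1 rfl,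
        F₆.realArr 1 rfl, F₅.realArr 1 rfl, F₄.realArr 1 rfl, F₃.realArr 1 rfl]
    rw [c.cnt_eq, c.p_eq, c.a_eq, e]
    exact hnet₂
  · intro i hi
    have hai := hclu.assign_lt i hi
    have e11 : s₉.natArr 11 = s.natArr 11 := by
      rw [F₉.natArr 11 rfl, F₈.natArr 11 rfl, F₇.natArr 11 rfl, F₆.natArr 11 rfl,
        F₅.natArr 11 rfl, F₄.natArr 11 rfl, F₃.natArr 11 rfl, F₂.natArr 11 rfl]
    rw [hdel i hi, e11, S.mem_del, F₉.natArr 9 rfl, hK₀ _ hai, hK₁ _ hai, F₈.natArr 8 rfl,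
      sum_ne_zero_iff_exists, sum_ne_zero_iff_exists]
    have x₀ : (∃ j ∈ neighbours X ρ cnt' p (a i), s₇.natArr 7 j ≠ 0) ↔
        ∃ j ∈ neighbours X ρ cnt' p (a i),
          ¬ Exempt n T τ (n₀ j + n₁ j) (N₀ j) (N₁ j) ∧ N₀ j ≤ N₁ j :=
      exists_congr fun j => and_congr_right fun hj => hm₀ j (mem_neighbours.1 hj).1
    have x₁ : (∃ j ∈ neighbours X ρ cnt' p (a i), s₇.natArr 8 j ≠ 0) ↔
        ∃ j ∈ neighbours X ρ cnt' p (a i),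
          ¬ Exempt n T τ (n₀ j + n₁ j) (N₀ j) (N₁ j) ∧ N₁ j < N₀ j :=
      exists_congr fun j => and_congr_right fun hj => hm₁ j (mem_neighbours.1 hj).1
    rw [x₀, x₁]
    exact or_congr_right (iff_and_self.2 fun _ => hi)
  · intro U hU
    have h1 := S.card_steepSet_le hU
    rw [S.weight_eq] at h1
    exact (mul_le_mul_of_nonneg_right (Nat.cast_le.2 h1) (by linarith)).trans hw
  · intro D hD U hU
    refine S.card_del_le_of_rate hD hρ0 (by linarith) hτ0 ?_ (by rw [h10]; exact hU)
    rw [S.weight_eq]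
    exact hrate

end SingleScale

/-! ### The algorithm -/

section Algorithm

variable {Ω : Type u} [MetricSpace Ω]

/-- The computations at all scales `4 ^ k`. -/
def allScales : Program :=
  .loop (.realLe (.var 2)
    (.add (.mul (.ofNat (.const 8)) (.ofNat (.var 0))) (.ofNat (.const 8)))) <|
  .seq scaleStep (.setReal 2 (.mul (.ofNat (.const 4)) (.var 2)))

theorem wp_allScales {d : ℕ → ℕ → ℝ} {X : ℕ → Ω} {n : ℕ} (hn1 : 1 ≤ n)
    (hd : ∀ i < n, ∀ j < n, d i j = dist (X i) (X j)) {s : State} {L : ℝ} {Y : ℕ → ℕ}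
    (hn : s.natVar 0 = n) (hcnt : s.natVar 3 = 0) (hsL : s.realVar 0 = L) (hL : 0 < L)
    (hsT : s.realVar 2 = 1) (hY : s.natArr 0 = Y) (hdel : ∀ i < n, s.natArr 11 i = 0)
    (hD : ∀ i < n, s.realArr 1 i = 1 / L) {D : ℕ} (hDD : DoublingWith Ω D) {V : Finset ℕ}
    (hV : ∀ T : ℝ, 1 ≤ T → (#(steepSet n X Y V (1 / (T * L))) : ℝ) * T ≤ n) :
    WP d allScales s fun t s' =>
      t ≤ 300 * n * n + (Nat.log 2 n + 5) * ((2 * Nat.log 2 n + 10) * (100 * n + 50)) + 20 ∧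
      (∀ i : ℕ, (4 : ℝ) ^ i ≤ 8 * n + 8 →
        (#(steepSet n X Y {u ∈ range n | s'.natArr 11 u = 0} (1 / (10 * 4 ^ i * L))) : ℝ) * 4 ^ i ≤
          2 * n) ∧
      #{u ∈ range n | s'.natArr 11 u ≠ 0} ≤
        (Nat.log 2 n + 5) * (3 * D ^ 3 * #(range n \ V)) := by
  classical
  -- The separation is expressed as four times the coming radius, which for `k ≥ 1` is the radius
  -- just used. Counting `300 n` steps per centre makes the refinement costs telescope.
  refine WP.loop (fun k t s' => s'.realVar 2 = 4 ^ k ∧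
    IsNet n X (1 / L) (4 * (1 / (10 * 4 ^ k * L))) (s'.natVar 3) (s'.natArr 1) (s'.natArr 2)
      (s'.realArr 1) ∧
    (∀ i < k, ∀ U : Finset ℕ, (∀ u ∈ U, u < n ∧ s'.natArr 11 u = 0) →
      (#(steepSet n X Y U (1 / (10 * 4 ^ i * L))) : ℝ) * 4 ^ i ≤ 2 * n) ∧
    #{u ∈ range n | s'.natArr 11 u ≠ 0} ≤ k * (3 * D ^ 3 * #(range n \ V)) ∧
    t ≤ 300 * n * s'.natVar 3 + k * ((2 * Nat.log 2 n + 10) * (100 * n + 50)))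
    (Nat.log 2 n + 5) ?_ ?_ ?_
  · refine ⟨by simpa using hsT, ⟨?_, ?_, ?_, ?_⟩, by simp, ?_, by simp⟩
    · simp [hcnt]
    · simp [hcnt]
    · simp [hcnt]
    · exact fun i hi => .inl (hD i hi)
    · rw [filter_false_of_mem fun i hi => not_not.2 (hdel i (mem_range.1 hi))]
      simp
  · rintro k t s₁ hF ⟨hT, hnet, hsteep, hcard, ht⟩ hb
    have g0 : s₁.natVar 0 = n := (hF.natVar 0 rfl).trans hn
    have gL : s₁.realVar 0 = L := (hF.realVar 0 rfl).trans hsL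
    have gY : s₁.natArr 0 = Y := (hF.natArr 0 rfl).trans hY
    have hk1 : (1 : ℝ) ≤ 4 ^ k := one_le_pow₀ (by norm_num)
    simp only [Test.Holds, RealExpr.eval, NatExpr.eval, g0, hT, Nat.cast_ofNat] at hb
    refine ⟨?_, .seq ?_⟩
    · have h1 : 4 ^ k ≤ 8 * n + 8 := by exact_mod_cast hb
      have h2 : n < 2 ^ (Nat.log 2 n + 1) := Nat.lt_pow_succ_log_self (by norm_num) n
      -- From `4 ^ k ≤ 8 n + 8` and `n + 1 ≤ 2 ^ (Nat.log 2 n + 1)`; the factor `16` leaves room for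
      -- strictness.
      have h3 : 2 ^ (2 * k) < 2 ^ (Nat.log 2 n + 5) := by
        rw [pow_mul, show Nat.log 2 n + 5 = Nat.log 2 n + 1 + 4 by ring, pow_add _ _ 4]
        norm_num
        omega
      have := (Nat.pow_lt_pow_iff_right (by norm_num)).1 h3
      omega
    refine (wp_scaleStep hn1 hd g0 rfl gL hL hT hk1 gY le_rfl hnet).mono ?_
    rintro t₂ s₂ F₂ ⟨hc, ht₂, hnet₂, del, hdel₂, hdelU, hdelV⟩
    have e2 : s₂.realVar 2 = 4 ^ k := (F₂.realVar 2 rfl).trans hT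
    refine .setReal ⟨?_, ?_, ?_, ?_, ?_⟩
    · simp [RealExpr.eval, NatExpr.eval, e2, pow_succ, mul_comm]
    · have : 4 * (1 / (10 * 4 ^ (k + 1) * L)) = 1 / (10 * 4 ^ k * L) := by
        rw [pow_succ]
        field_simp
      rw [this]
      exact hnet₂
    · intro i hi U hU
      have hU' : ∀ u ∈ U, u < n ∧ s₁.natArr 11 u = 0 ∧ u ∉ del := by
        intro u hu
        obtain ⟨h1, h2⟩ := hU u hu
        have h3 := (not_congr (hdel₂ u h1)).1 (not_not.2 h2)
        rw [not_or, not_not] at h3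
        exact ⟨h1, h3⟩
      rcases Nat.lt_succ_iff_lt_or_eq.1 hi with hi | rfl
      · exact hsteep i hi U fun u hu => ⟨(hU' u hu).1, (hU' u hu).2.1⟩
      · exact hdelU U fun u hu => ⟨(hU' u hu).1, (hU' u hu).2.2⟩
    · have h1 : ({u ∈ range n | s₂.natArr 11 u ≠ 0} : Finset ℕ) ⊆
          {u ∈ range n | s₁.natArr 11 u ≠ 0} ∪ del := by
        intro u hu
        obtain ⟨h2, h3⟩ := mem_filter.1 hu
        rcases (hdel₂ u (mem_range.1 h2)).1 h3 with h | h
        · exact mem_union_left _ (mem_filter.2 ⟨h2, h⟩)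
        · exact mem_union_right _ h
      have h2 := hdelV D hDD V (hV _ hk1)
      calc _ ≤ _ := card_le_card h1
        _ ≤ _ := card_union_le _ _
        _ ≤ _ := Nat.add_le_add hcard h2
        _ = _ := by ring
    · have e3 : 300 * n * s₂.natVar 3 =
          300 * n * s₁.natVar 3 + 300 * n * (s₂.natVar 3 - s₁.natVar 3) := by
        rw [← mul_add]
        congr 1
        omega
      have e4 : (k + 1) * ((2 * Nat.log 2 n + 10) * (100 * n + 50)) =
        k * ((2 * Nat.log 2 n + 10) * (100 * n + 50)) +
          ((2 * Nat.log 2 n + 10) * (100 * n + 40) + 20 * Nat.log 2 n + 100) := by ring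
      change _ ≤ 300 * n * s₂.natVar 3 + _
      rw [e3, e4]
      simp only [Test.cost, RealExpr.cost, NatExpr.cost]
      omega
  · rintro k t s₁ hk hF ⟨hT, hnet, hsteep, hcard, ht⟩ hb
    have g0 : s₁.natVar 0 = n := (hF.natVar 0 rfl).trans hn
    simp only [Test.Holds, RealExpr.eval, NatExpr.eval, g0, hT, Nat.cast_ofNat, not_le] at hb
    refine ⟨?_, fun i hi => ?_, hcard.trans (Nat.mul_le_mul_right _ hk)⟩
    · have h1 : 300 * n * s₁.natVar 3 ≤ 300 * n * n :=
        Nat.mul_le_mul_left _ (hnet.cnt_le (by positivity))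
      have h2 := Nat.mul_le_mul_right ((2 * Nat.log 2 n + 10) * (100 * n + 50)) hk
      simp only [Test.cost, RealExpr.cost, NatExpr.cost]
      omega
    · refine hsteep i ?_ _ fun u hu => ?_
      · exact (pow_lt_pow_iff_right₀ (by norm_num : (1 : ℝ) < 4)).1 (hi.trans_lt hb)
      · simpa using hu

/-- The algorithm. The memory is used as follows.

* Natural variables: `0` the number of points, `1` and `2` loop counters, `3` the number of
  centres, `4` the number of centres before the current scale, `5` the weight of the exempt
  clusters, `6` an accumulator.
* Real variables: `0` the slope target, `1` the radius of the net, `2` the scale, `3` the rate,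
  `4` and `5` truncated distances to the kept points.
* Arrays of natural numbers: `0` the labels, `1` the centres, `2` the cluster of each point, `3` and
  `4` the label counts of the clusters, `5` and `6` those of their neighbourhoods, `7` to `10` the
  marks of the clusters and their sums over neighbourhoods, `11` the marks of the deleted points.
* Arrays of real numbers: `0` the output, `1` the truncated distances to the centres. -/
def slopeRemoval : Program :=
  .seq (.setNat 1 (.const 0)) <|
  .seq (forLoop 1 0 (.putReal 1 (.var 1) (.div (.ofNat (.const 1)) (.var 0)))) <|
  .seq (.setReal 2 (.ofNat (.const 1))) <|
  .seq allScales interpolate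

theorem wp_slopeRemoval {d : ℕ → ℕ → ℝ} {X : ℕ → Ω} {n : ℕ} (hn1 : 1 ≤ n)
    (hd : ∀ i < n, ∀ j < n, d i j = dist (X i) (X j)) {y : Fin n → Fin 2} {L : ℝ} (hL : 0 < L)
    {Y : ℕ → ℕ} (hY : (initState y L).natArr 0 = Y) {D : ℕ} (hDD : DoublingWith Ω D)
    {V : Finset ℕ} (hV : ∀ T : ℝ, 1 ≤ T → (#(steepSet n X Y V (1 / (T * L))) : ℝ) * T ≤ n) :
    WP d slopeRemoval (initState y L) fun t s' =>
      t ≤ 340 * n * n + 80 * n + 50 +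
        (Nat.log 2 n + 5) * ((2 * Nat.log 2 n + 10) * (100 * n + 50)) ∧
      ∃ U ⊆ range n, (∀ i : ℕ, (4 : ℝ) ^ i ≤ 8 * n + 8 →
        (#(steepSet n X Y U (1 / (10 * 4 ^ i * L))) : ℝ) * 4 ^ i ≤ 2 * n) ∧
      #(range n \ U) ≤ (Nat.log 2 n + 5) * (3 * D ^ 3 * #(range n \ V)) ∧
      ∀ i < n, ∃ α β : ℝ, IsTruncDist X (1 / L) (fun u => u ∈ U ∧ Y u = 0) i α ∧
        IsTruncDist X (1 / L) (fun u => u ∈ U ∧ Y u ≠ 0) i β ∧ s'.realArr 0 i = α / (α + β) := by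
  refine .seq (.setNat (.seq ?_))
  refine WP.for_const (fun k s' => ∀ i < k, s'.realArr 1 i = 1 / L) (k₀ := 0) (N := n) 6
    rfl rfl (by decide) rfl (by simp [initState]) (by omega) (by simp) ?_ ?_
  · rintro k s₁ hF - hkn hk hI
    have gL : s₁.realVar 0 = L := by rw [hF.realVar 0 rfl]; simp [initState]
    refine .putReal ⟨by decide, fun i hi => ?_⟩
    simp only [NatExpr.eval, RealExpr.eval, hk, gL, writeArr_same, Nat.cast_one]
    rcases Nat.lt_succ_iff_lt_or_eq.1 hi with hi | rfl
    · rw [Function.update_of_ne hi.ne]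
      exact hI i hi
    · rw [Function.update_self]
  rintro t₁ s₁ F₁ ht₁ hD
  refine .seq (.setReal (.seq ?_))
  have e0 : s₁.natVar 0 = n := by rw [F₁.natVar 0 rfl]; simp [initState]
  have eL : s₁.realVar 0 = L := by rw [F₁.realVar 0 rfl]; simp [initState]
  have eY : s₁.natArr 0 = Y := (F₁.natArr 0 rfl).trans hY
  refine WP.mono (wp_allScales hn1 hd (by exact e0) (by rw [F₁.natVar 3 rfl]; simp [initState])
    (by simpa using eL) hL (by simp [RealExpr.eval, NatExpr.eval]) (by exact eY)
    (fun i _ => by rw [F₁.natArr 11 rfl]; simp [initState]) (by exact hD) hDD hV) ?_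
  rintro t₂ s₂ F₂ ⟨ht₂, hsteep, hcard⟩
  refine (wp_interpolate hd (L := L) ((F₂.natVar 0 rfl).trans e0)
    (by rw [F₂.realVar 0 rfl]; simpa using eL) ((F₂.natArr 0 rfl).trans eY) rfl).mono ?_
  rintro t₃ s₃ F₃ ⟨ht₃, hout⟩
  refine ⟨?_, {u ∈ range n | s₂.natArr 11 u = 0}, filter_subset _ _, hsteep, ?_, ?_⟩
  · have e1 : n * (40 * n + 50) = 40 * (n * n) + 50 * n := by ring
    have e2 : 340 * n * n = 340 * (n * n) := by ring
    have e3 : 300 * n * n = 300 * (n * n) := by ring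
    rw [e1] at ht₃
    rw [e3] at ht₂
    rw [e2]
    simp only [RealExpr.cost, NatExpr.cost]
    omega
  · rw [← filter_not]
    exact hcard
  · intro i hi
    obtain ⟨α, β, hα, hβ, hz⟩ := hout i hi
    exact ⟨α, β, hα.congr fun u => by simp [and_assoc], hβ.congr fun u => by simp [and_assoc], hz⟩

/-! ### Logarithmic estimates and degenerate cases -/

theorem sq_log_add_five_le {n : ℕ} (hn : 1 ≤ n) : (Nat.log 2 n + 5) ^ 2 ≤ 25 * n := by
  have key : ∀ q : ℕ, (q + 5) ^ 2 ≤ 25 * 2 ^ q := by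
    intro q
    induction q with
    | zero => norm_num
    | succ q ih =>
      have h : (q + 1 + 5) ^ 2 ≤ 2 * (q + 5) ^ 2 := by nlinarith [Nat.zero_le q]
      rw [pow_succ 2 q]
      omega
  exact (key _).trans (Nat.mul_le_mul_left _ (Nat.pow_log_le_self 2 (by omega)))

/-- Both `Nat.log 2 n` and `1` are at most `log n / log 2`, and `6 / log 2 < 9`. -/
theorem log_add_five_le {n : ℕ} (hn : 2 ≤ n) : ((Nat.log 2 n + 5 : ℕ) : ℝ) ≤ 9 * Real.log n := by
  have h1 : (2 : ℝ) ^ (Nat.log 2 n) ≤ n := by exact_mod_cast Nat.pow_log_le_self 2 (by omega)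
  have h2 : (Nat.log 2 n : ℝ) * Real.log 2 ≤ Real.log n := by
    rw [← Real.log_pow]
    exact Real.log_le_log (by positivity) h1
  have h3 : Real.log 2 ≤ Real.log n := Real.log_le_log (by norm_num) (by exact_mod_cast hn)
  have h4 := Real.log_two_gt_d9
  have h5 : (0 : ℝ) ≤ (Nat.log 2 n : ℝ) := Nat.cast_nonneg _
  push_cast
  nlinarith

theorem slopeBounded_of_subsingleton {n : ℕ} [Subsingleton (Fin n)] (x : Fin n → Ω) {L : ℝ}
    (hL : 0 < L) (z : Fin n → ℝ) : SlopeBounded x L z := by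
  intro t ht _
  have hs : ∀ i, slope x z i = 0 := fun i =>
    nonpos_iff_eq_zero.1 (iSup_le fun j => by rw [Subsingleton.elim j i]; simp)
  have h : {i : Fin n | ENNReal.ofReal (t * L) ≤ slope x z i} = ∅ := by
    ext i
    simp only [Set.mem_ofPred_eq, hs, nonpos_iff_eq_zero, ENNReal.ofReal_eq_zero,
      Set.mem_empty_iff_false, iff_false, not_le]
    positivity
  rw [h, Set.ncard_empty, Nat.cast_zero]
  positivity

theorem one_le_of_doublingWith {D : ℕ} (h : DoublingWith Ω D) (c : Ω) : 1 ≤ D := by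
  obtain ⟨F, hF, hcov⟩ := h c 1 one_pos
  have := hcov (Metric.mem_closedBall_self zero_le_one)
  simp only [Set.mem_iUnion] at this
  obtain ⟨p, hp, -⟩ := this
  exact (card_pos.2 ⟨p, hp⟩).trans_le hF

end Algorithm

end SlopeRemoval

/-! ### Assembly of the approximation and time bounds -/

open SlopeRemoval Finset in
theorem lemma5p4 :
    ∃ (P : SlopeRemoval.Program) (C : ℝ), 2 ≤ C ∧
      ∀ (Ω : Type u) [MetricSpace Ω],
        Metric.ediam (Set.univ : Set Ω) ≤ 1 → SlopeRemoval.IsDoubling Ω →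
        ∀ (n : ℕ), 1 ≤ n → ∀ (x : Fin n → Ω) (y : Fin n → Fin 2) (L : ℝ), 0 < L →
          ∃ (T : ℕ) (s : SlopeRemoval.State),
            SlopeRemoval.Exec (SlopeRemoval.distOracle x) P (SlopeRemoval.initState y L) T s ∧
            (T : ℝ) ≤ C * (n : ℝ) ^ 2
              + C * (2 : ℝ) ^ (C * SlopeRemoval.ddim Ω) * ((n : ℝ) * Real.log n ^ 2) ∧
            SlopeRemoval.IsBicriteria x y L
              (C * (2 : ℝ) ^ (C * SlopeRemoval.ddim Ω) * Real.log n) C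
              (SlopeRemoval.output n s) := by
  -- The constant dominates the slope factor `80`, the count factor `27 = 9 * 3`, the exponent `3`
  -- of `D` and the coefficients of the running time.
  refine ⟨slopeRemoval, 10000, by norm_num, ?_⟩
  intro Ω _ _ hdoub n hn1 x y L hL
  have hD : DoublingWith Ω (sInf {D : ℕ | DoublingWith Ω D}) := Nat.sInf_mem hdoub
  set D := sInf {D : ℕ | DoublingWith Ω D} with hDdef
  let X : ℕ → Ω := fun i => if h : i < n then x ⟨i, h⟩ else x ⟨0, hn1⟩
  have hX : ∀ i : Fin n, X i = x i := fun i => by simp [X]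
  have hd : ∀ i < n, ∀ j < n, distOracle x i j = dist (X i) (X j) := by
    intro i hi j hj
    simp [distOracle, X, hi, hj]
  obtain ⟨Y, hY⟩ : ∃ Y, (initState y L).natArr 0 = Y := ⟨_, rfl⟩
  have hYy : ∀ i : Fin n, Y i = (y i : ℕ) := fun i => by simp [← hY, initState]
  obtain ⟨z, hz, hzopt⟩ : ∃ z : Fin n → ℝ, Feasible x L z ∧ relabelCount y z = opt x y L :=
    Nat.sInf_mem (s := {k : ℕ | ∃ z : Fin n → ℝ, Feasible x L z ∧ relabelCount y z = k})
      ⟨_, _, feasible_const x hL, rfl⟩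
  classical
  let V : Finset ℕ := {i ∈ range n | ∃ h : i < n, z ⟨i, h⟩ = ((y ⟨i, h⟩ : ℕ) : ℝ)}
  have hVcard : #(range n \ V) = opt x y L := by
    rw [← hzopt, relabelCount, ← Set.ncard_image_of_injective _ Fin.val_injective,
      ← Set.ncard_coe_finset]
    congr 1
    ext i
    simp only [V, coe_sdiff, coe_range, coe_filter, Set.mem_sdiff, Set.mem_Iio, Set.mem_image,
      Set.mem_ofPred_eq, mem_range]
    constructor
    · rintro ⟨hi, h⟩
      exact ⟨⟨i, hi⟩, fun h' => h ⟨hi, hi, h'⟩, rfl⟩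
    · rintro ⟨j, hj, rfl⟩
      exact ⟨j.2, fun h => hj h.2.2⟩
  have hV : ∀ T : ℝ, 1 ≤ T → (#(steepSet n X Y V (1 / (T * L))) : ℝ) * T ≤ n := fun T hT =>
    hz.card_steepSet_le hX hYy hL (fun i hi => (mem_filter.1 hi).2) hT
  obtain ⟨T, s, hexec, hT, U, hU, hsteep, hcard, hout⟩ := wp_slopeRemoval hn1 hd hL hY hD hV
  rw [hVcard] at hcard
  have hDpos : 1 ≤ D := one_le_of_doublingWith hD (x ⟨0, hn1⟩)
  have hddim0 : 0 ≤ ddim Ω := Real.logb_nonneg (by norm_num) (by exact_mod_cast hDpos)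
  have hDpow : ((D : ℝ)) ^ 3 ≤ (2 : ℝ) ^ (10000 * ddim Ω) := by
    have h1 : (2 : ℝ) ^ (ddim Ω) = D :=
      Real.rpow_logb (by norm_num) (by norm_num) (by exact_mod_cast hDpos)
    rw [← h1, ← Real.rpow_natCast, ← Real.rpow_mul (by norm_num)]
    refine Real.rpow_le_rpow_of_exponent_le (by norm_num) ?_
    push_cast
    linarith
  refine ⟨T, s, hexec, ?_, ?_⟩
  -- The term `n log² n` is absorbed into `n²` through `(Nat.log 2 n + 5) ^ 2 ≤ 25 n`.
  · have h1 : T ≤ 10000 * n ^ 2 := by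
      have h2 := sq_log_add_five_le hn1
      have h3 : (Nat.log 2 n + 5) * ((2 * Nat.log 2 n + 10) * (100 * n + 50)) =
        (Nat.log 2 n + 5) ^ 2 * (200 * n + 100) := by ring
      have h4 := Nat.mul_le_mul_right (200 * n + 100) h2
      rw [h3] at hT
      nlinarith
    have h2 : (T : ℝ) ≤ 10000 * (n : ℝ) ^ 2 := by exact_mod_cast h1
    have h3 : (0 : ℝ) ≤ 10000 * (2 : ℝ) ^ (10000 * ddim Ω) * ((n : ℝ) * Real.log n ^ 2) := by
      positivity
    linarith
  · choose! α β hα hβ hαβ using hout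
    obtain ⟨h01, hkeep, hslope⟩ := interpolation_bounds (b := 80) (z := output n s) hX hYy hL
      (by norm_num) (fun t ht htn => card_steepSet_le_of_dyadic hL hsteep ht htn) hα hβ
      fun i => hαβ i i.2
    refine ⟨h01, ?_, hslope.mono (by linarith)⟩
    have h1 : relabelCount y (output n s) ≤ #(range n \ U) := by
      rw [relabelCount, ← Set.ncard_image_of_injective _ Fin.val_injective,
        ← Set.ncard_coe_finset]
      refine Set.ncard_le_ncard ?_ (Finset.finite_toSet _)
      rintro _ ⟨i, hi, rfl⟩
      exact mem_coe.2 (mem_sdiff.2 ⟨mem_range.2 i.2, fun h => hi (hkeep i h)⟩)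
    have h2 : (relabelCount y (output n s) : ℝ) ≤
        ((Nat.log 2 n + 5 : ℕ) : ℝ) * (3 * (D : ℝ) ^ 3 * opt x y L) := by
      exact_mod_cast h1.trans hcard
    -- For `n = 1` the factor `log n` vanishes, so nothing may be relabelled; a single point has
    -- slope zero and the optimum is indeed zero.
    have hopt1 : n = 1 → opt x y L = 0 := by
      rintro rfl
      refine Nat.le_zero.1 (Nat.sInf_le ⟨fun i => ((y i : ℕ) : ℝ), ⟨fun i => ?_, ?_⟩, ?_⟩)
      · refine ⟨Nat.cast_nonneg _, ?_⟩
        change ((y i : ℕ) : ℝ) ≤ 1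
        exact_mod_cast Nat.lt_succ_iff.1 (y i).2
      · exact slopeBounded_of_subsingleton x hL _
      · simp [relabelCount]
    rcases hn1.eq_or_lt with hn | hn
    · rw [hopt1 hn.symm] at h2 ⊢
      simpa using h2
    · refine h2.trans ?_
      have h3 := log_add_five_le (show 2 ≤ n from hn)
      have h4 : 0 ≤ Real.log n := Real.log_natCast_nonneg n
      calc ((Nat.log 2 n + 5 : ℕ) : ℝ) * (3 * (D : ℝ) ^ 3 * opt x y L)
          ≤ (9 * Real.log n) * (3 * (2 : ℝ) ^ (10000 * ddim Ω) * opt x y L) := by gcongr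
        _ = 27 * ((2 : ℝ) ^ (10000 * ddim Ω) * Real.log n * opt x y L) := by ring
        _ ≤ 10000 * ((2 : ℝ) ^ (10000 * ddim Ω) * Real.log n * opt x y L) := by
            gcongr
            norm_num
        _ = _ := by ring
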